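/- **Theorem 3.1.** Let $K$ be a field, $R=\bigoplus_{p\in\mathbb N}R_p$ a positively graded associative unital $K$-algebra, $F=\{f_j\}_{j\in J}$ a family of elements of $R$, $I$ the two-sided ideal of $R$ generated by $F$, and $A=R/I$. For $0\ne f\in R$ let $\deg f$ be the largest $p$ for which the component of $f$ in $R_p$ is nonzero, and let $\mathbf{LH}(f)\in R_{\deg f}$ be that component; put $\deg 0=0$ and $\mathbf{LH}(0)=0$. Write $\langle S\rangle$ for the two-sided ideal generated by $S$, $\mathbf{LH}(F)=\{\mathbf{LH}(f_j)\}_{j\in J}$ and $\mathbf{LH}(I)=\{\mathbf{LH}(f): f\in I\}$. Let $F_pR=\bigoplus_{i\le p}R_i$, let $F_pA=(F_pR+I)/I$, let $G(A)=\bigoplus_p F_pA/F_{p-1}A$ (with $F_{-1}A=0$), and let $\phi:R\to G(A)$ be the natural graded map, sending $r\in R_p$ to the class of $r+I$ in $F_pA/F_{p-1}A$. Let $U$ be the $K$-vector space with basis $X=\{x_j\}_{j\in J}$. For a family $c=\{c_j\}_{j\in J}$ in $R$, the Shafarevich complex $\mathrm{Sh}(X|c,R)$ is the complex of $R$-$R$-bimodules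 $\mathrm{Sh}_n=R\otimes_K U\otimes_K R\otimes_K\cdots\otimes_K U\otimes_K R$ ($n$ factors $U$, $n+1$ factors $R$), $n\ge 0$, with $$d_n(a_0\otimes x_{j_1}\otimes a_1\otimes\cdots\otimes x_{j_n}\otimes a_n)=\sum_{i=1}^n(-1)^{i-1}a_0\otimes x_{j_1}\otimes\cdots\otimes x_{j_{i-1}}\otimes(a_{i-1}c_{j_i}a_i)\otimes x_{j_{i+1}}\otimes\cdots\otimes x_{j_n}\otimes a_n .$$ Give $x_j$ the degree $\deg f_j$. Then $\mathrm{Sh}(X|\mathbf{LH}(F),R)$ is a graded complex: its part of degree $p$ is spanned by the tensors $a_0\otimes x_{j_1}\otimes\cdots\otimes x_{j_n}\otimes a_n$ with homogeneous $a_i$ and total degree $p$. And $\mathrm{Sh}(X|F,R)$ is a filtered complex: $F_p\mathrm{Sh}_n(X|F,R)$ is spanned by such tensors of total degree at most $p$. Let $\widetilde{\mathrm{Sh}}(X|F,R)=\bigoplus_pF_p\mathrm{Sh}(X|F,R)$ and $G(\mathrm{Sh})(X|F,R)=\bigoplus_pF_p\mathrm{Sh}(X|F,R)/F_{p-1}\mathrm{Sh}(X|F,R)$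 be the associated Rees complex and associated graded complex, let $\varphi:\mathrm{Sh}(X|\mathbf{LH}(F),R)\to G(\mathrm{Sh})(X|F,R)$ and $\psi:\widetilde{\mathrm{Sh}}(X|F,R)\to G(\mathrm{Sh})(X|F,R)$ be the canonical graded morphisms, and let $\varphi_*$, $\psi_*$ be the induced maps on homology. Put $E_1=\varphi_*^{-1}(\operatorname{Im}\psi_*)\subseteq H_1(\mathrm{Sh}(X|\mathbf{LH}(F),R))$, a graded subspace; its homogeneous elements are called extendable classes. The following statements are equivalent. 1. $\langle\mathbf{LH}(F)\rangle=\langle\mathbf{LH}(I)\rangle$. 2. (Restatement of 1: the general PBW property.) $\phi$ induces an isomorphism of $K$-algebras $\rho:R/\langle\mathbf{LH}(F)\rangle\to G(A)$. 3. $E_1=H_1(\mathrm{Sh}(X|\mathbf{LH}(F),R))$. 4. The $R$-$R$-bimodule $H_1(\mathrm{Sh}(X|\mathbf{LH}(F),R))$ is generated by extendable classes. -/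

import Mathlib

open scoped TensorProduct DirectSum

noncomputable section

namespace PBW

/-! ### Homology and filtrations of modules -/

section Linear

variable {K : Type*} [Field K]

/-- The homology `ker g / im f` of `A --f--> B --g--> C` at `B`. -/
abbrev Homology {A B C : Type*} [AddCommGroup A] [Module K A] [AddCommGroup B] [Module K B]
    [AddCommGroup C] [Module K C] (f : A →ₗ[K] B) (g : B →ₗ[K] C) : Type _ :=
  LinearMap.ker g ⧸ (LinearMap.range f).comap (LinearMap.ker g).subtype

/-- The map induced on homology by a morphism `(α, β, γ)` from `A ⟶ B ⟶ C` to `A' ⟶ B' ⟶ C'`. -/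
def Homology.map {A B C A' B' C' : Type*} [AddCommGroup A] [Module K A] [AddCommGroup B]
    [Module K B] [AddCommGroup C] [Module K C] [AddCommGroup A'] [Module K A'] [AddCommGroup B']
    [Module K B'] [AddCommGroup C'] [Module K C']
    {f : A →ₗ[K] B} {g : B →ₗ[K] C} {f' : A' →ₗ[K] B'} {g' : B' →ₗ[K] C'}
    (α : A →ₗ[K] A') (β : B →ₗ[K] B') (γ : C →ₗ[K] C')
    (h₁ : ∀ x, β (f x) = f' (α x)) (h₂ : ∀ y, γ (g y) = g' (β y)) :
    Homology f g →ₗ[K] Homology f' g' :=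
  Submodule.mapQ _ _
    (β.restrict (p := LinearMap.ker g) (q := LinearMap.ker g') (fun y hy => by
      rw [LinearMap.mem_ker] at hy ⊢
      rw [← h₂, hy, map_zero]))
    (by
      rintro ⟨y, hy⟩ ⟨x, hx⟩
      exact ⟨α x, by rw [← h₁, hx]; rfl⟩)

/-- For a filtration `F₀ ⊆ F₁ ⊆ ⋯`, the term `F_{p-1}`, where `F_{-1} = 0`. -/
def prev {M : Type*} [AddCommGroup M] [Module K M] (F : ℕ → Submodule K M) : ℕ → Submodule K M
  | 0 => ⊥
  | p + 1 => F p

/-- The degree-`p` part `F_p / F_{p-1}` of the associated graded object of a filtration. -/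
def Gr {M : Type*} [AddCommGroup M] [Module K M] (F : ℕ → Submodule K M) (p : ℕ) : Type _ :=
  F p ⧸ (prev F p).comap (F p).subtype

instance {M : Type*} [AddCommGroup M] [Module K M] (F : ℕ → Submodule K M) (p : ℕ) :
    AddCommGroup (Gr F p) :=
  inferInstanceAs (AddCommGroup (F p ⧸ (prev F p).comap (F p).subtype))

instance {M : Type*} [AddCommGroup M] [Module K M] (F : ℕ → Submodule K M) (p : ℕ) :
    Module K (Gr F p) :=
  inferInstanceAs (Module K (F p ⧸ (prev F p).comap (F p).subtype))

/-- The canonical projection `F_p → F_p / F_{p-1}`. -/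
def Gr.proj {M : Type*} [AddCommGroup M] [Module K M] (F : ℕ → Submodule K M) (p : ℕ) :
    F p →ₗ[K] Gr F p :=
  ((prev F p).comap (F p).subtype).mkQ

theorem Gr.proj_eq_iff {M : Type*} [AddCommGroup M] [Module K M] {F : ℕ → Submodule K M}
    {p : ℕ} (x y : F p) : Gr.proj F p x = Gr.proj F p y ↔ (x : M) - y ∈ prev F p :=
  Submodule.Quotient.eq _

/-- The map `F_p / F_{p-1} → F'_p / F'_{p-1}` induced by a filtered homomorphism. -/
def Gr.map {M M' : Type*} [AddCommGroup M] [Module K M] [AddCommGroup M'] [Module K M']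
    {F : ℕ → Submodule K M} {F' : ℕ → Submodule K M'} (g : M →ₗ[K] M')
    (hg : ∀ p, ∀ x ∈ F p, g x ∈ F' p) (p : ℕ) : Gr F p →ₗ[K] Gr F' p :=
  Submodule.mapQ _ _ (g.restrict (hg p)) (by
    rintro ⟨x, hx⟩ h
    cases p with
    | zero =>
      have h0 : x = 0 := h
      subst h0
      exact map_zero g
    | succ p => exact hg p x h)

theorem prev_mono {M : Type*} [AddCommGroup M] [Module K M] {F : ℕ → Submodule K M}
    (hF : Monotone F) : Monotone (prev F) := by
  intro p q hpq
  cases p with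
  | zero => exact bot_le
  | succ p =>
    cases q with
    | zero => omega
    | succ q => exact hF (by omega)

theorem prev_le {M : Type*} [AddCommGroup M] [Module K M] {F : ℕ → Submodule K M}
    (hF : Monotone F) (p : ℕ) : prev F p ≤ F p := by
  cases p with
  | zero => exact bot_le
  | succ p => exact hF (by omega)

theorem le_prev {M : Type*} [AddCommGroup M] [Module K M] {F : ℕ → Submodule K M}
    (hF : Monotone F) {p q : ℕ} (h : q < p) : F q ≤ prev F p := by
  cases p with
  | zero => omega
  | succ p => exact hF (by omega)

end Linear

/-! ### The associated graded algebra of a filtered algebra -/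

section GrAlgebra

variable {K A : Type*} [Field K] [Ring A] [Algebra K A]

/-- An exhaustive `ℕ`-filtration of an algebra by subspaces with `1 ∈ F₀` and
`F_p F_q ⊆ F_{p+q}`. -/
class AlgFiltration (F : ℕ → Submodule K A) : Prop where
  mono : Monotone F
  exhaustive : ∀ a, ∃ p, a ∈ F p
  one_mem : (1 : A) ∈ F 0
  mul_mem : ∀ {p q : ℕ} {a b : A}, a ∈ F p → b ∈ F q → a * b ∈ F (p + q)

variable (F : ℕ → Submodule K A)

/-- The class of `a ∈ F_p` in `F_p / F_{p-1}`. -/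
def Gr.mk (p : ℕ) (a : A) (ha : a ∈ F p) : Gr F p :=
  Gr.proj F p ⟨a, ha⟩

variable {F}

theorem Gr.ind {p : ℕ} {P : Gr F p → Prop} (h : ∀ a ha, P (Gr.mk F p a ha)) (x : Gr F p) : P x :=
  Submodule.Quotient.induction_on _ x fun y => h y.1 y.2

theorem Gr.mk_congr {p q : ℕ} {a b : A} {ha : a ∈ F p} {hb : b ∈ F q} (hpq : p = q) (hab : a = b) :
    (⟨p, Gr.mk F p a ha⟩ : GradedMonoid (Gr F)) = ⟨q, Gr.mk F q b hb⟩ := by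
  subst hpq; subst hab; rfl

theorem Gr.mk_eq {p : ℕ} {a b : A} {ha : a ∈ F p} {hb : b ∈ F p} (hab : a = b) :
    Gr.mk F p a ha = Gr.mk F p b hb := by
  subst hab; rfl

variable (F) [AlgFiltration F]

theorem prev_mul_mem {p q : ℕ} {a b : A} (ha : a ∈ prev F p) (hb : b ∈ F q) :
    a * b ∈ prev F (p + q) := by
  cases p with
  | zero =>
    have : a = 0 := ha
    simp [this]
  | succ p =>
    exact le_prev AlgFiltration.mono (by omega) (AlgFiltration.mul_mem (F := F) (p := p) ha hb)

theorem mul_prev_mem {p q : ℕ} {a b : A} (ha : a ∈ F p) (hb : b ∈ prev F q) :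
    a * b ∈ prev F (p + q) := by
  cases q with
  | zero =>
    have : b = 0 := hb
    simp [this]
  | succ q =>
    exact le_prev AlgFiltration.mono (by omega) (AlgFiltration.mul_mem (F := F) (q := q) ha hb)

/-- Multiplication `(F_p / F_{p-1}) × (F_q / F_{q-1}) → F_{p+q} / F_{p+q-1}`, `[a] [b] = [a b]`. -/
def Gr.mul {p q : ℕ} : Gr F p → Gr F q → Gr F (p + q) :=
  Quotient.map₂ (sa := ((prev F p).comap (F p).subtype).quotientRel)
    (sb := ((prev F q).comap (F q).subtype).quotientRel)
    (sc := ((prev F (p + q)).comap (F (p + q)).subtype).quotientRel) (fun a b => ⟨a.1 * b.1, AlgFiltration.mul_mem a.2 b.2⟩) (by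
    rintro ⟨a, ha⟩ ⟨a', ha'⟩ haa ⟨b, hb⟩ ⟨b', hb'⟩ hbb
    have h₁ : a - a' ∈ prev F p :=
      (Submodule.quotientRel_def ((prev F p).comap (F p).subtype)).1 haa
    have h₂ : b - b' ∈ prev F q :=
      (Submodule.quotientRel_def ((prev F q).comap (F q).subtype)).1 hbb
    refine (Submodule.quotientRel_def _).2 ?_
    change a * b - a' * b' ∈ prev F (p + q)
    have : a * b - a' * b' = (a - a') * b + a' * (b - b') := by noncomm_ring
    rw [this]
    exact add_mem (prev_mul_mem F h₁ hb) (mul_prev_mem F ha' h₂))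

theorem Gr.mk_mul_mk {p q : ℕ} {a b : A} (ha : a ∈ F p) (hb : b ∈ F q) :
    Gr.mul F (Gr.mk F p a ha) (Gr.mk F q b hb) =
      Gr.mk F (p + q) (a * b) (AlgFiltration.mul_mem ha hb) := rfl

theorem natCast_mem (n : ℕ) : (n : A) ∈ F 0 := by
  rw [← nsmul_one]; exact nsmul_mem AlgFiltration.one_mem n

theorem intCast_mem (n : ℤ) : (n : A) ∈ F 0 := by
  rw [← zsmul_one]; exact zsmul_mem AlgFiltration.one_mem n

theorem algebraMap_mem (k : K) : algebraMap K A k ∈ F 0 := by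
  rw [Algebra.algebraMap_eq_smul_one]; exact Submodule.smul_mem _ _ AlgFiltration.one_mem

instance : GradedMonoid.GMul (Gr F) where
  mul := Gr.mul F

instance : GradedMonoid.GOne (Gr F) where
  one := Gr.mk F 0 1 AlgFiltration.one_mem

instance : GradedMonoid.GMonoid (Gr F) where
  one_mul := by
    rintro ⟨p, x⟩
    induction x using Gr.ind with
    | h a ha => exact Gr.mk_congr (zero_add p) (one_mul a)
  mul_one := by
    rintro ⟨p, x⟩
    induction x using Gr.ind with
    | h a ha => exact Gr.mk_congr (add_zero p) (mul_one a)
  mul_assoc := by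
    rintro ⟨p, x⟩ ⟨q, y⟩ ⟨r, z⟩
    induction x using Gr.ind with
    | h a ha =>
    induction y using Gr.ind with
    | h b hb =>
    induction z using Gr.ind with
    | h c hc => exact Gr.mk_congr (add_assoc p q r) (mul_assoc a b c)

/-- The associated graded algebra `⨁ p, F_p / F_{p-1}` is a ring. -/
instance : DirectSum.GRing (Gr F) where
  mul_zero := by
    intro p q x
    induction x using Gr.ind with
    | h a ha => exact Gr.mk_eq (ha := AlgFiltration.mul_mem ha (zero_mem _)) (hb := zero_mem _)
                  (mul_zero a)
  zero_mul := by
    intro p q x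
    induction x using Gr.ind with
    | h a ha => exact Gr.mk_eq (ha := AlgFiltration.mul_mem (zero_mem _) ha) (hb := zero_mem _)
                  (zero_mul a)
  mul_add := by
    intro p q x y z
    induction x using Gr.ind with
    | h a ha =>
    induction y using Gr.ind with
    | h b hb =>
    induction z using Gr.ind with
    | h c hc =>
      exact Gr.mk_eq (ha := AlgFiltration.mul_mem ha (add_mem hb hc))
        (hb := add_mem (AlgFiltration.mul_mem ha hb) (AlgFiltration.mul_mem ha hc)) (mul_add a b c)
  add_mul := by
    intro p q x y z
    induction x using Gr.ind with
    | h a ha =>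
    induction y using Gr.ind with
    | h b hb =>
    induction z using Gr.ind with
    | h c hc =>
      exact Gr.mk_eq (ha := AlgFiltration.mul_mem (add_mem ha hb) hc)
        (hb := add_mem (AlgFiltration.mul_mem ha hc) (AlgFiltration.mul_mem hb hc)) (add_mul a b c)
  natCast n := Gr.mk F 0 n (natCast_mem F n)
  natCast_zero := Gr.mk_eq (hb := zero_mem _) Nat.cast_zero
  natCast_succ n := Gr.mk_eq (hb := add_mem (natCast_mem F n) AlgFiltration.one_mem)
    (Nat.cast_succ n)
  intCast n := Gr.mk F 0 n (intCast_mem F n)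
  intCast_ofNat n := Gr.mk_eq (Int.cast_natCast n)
  intCast_negSucc_ofNat n := Gr.mk_eq (hb := neg_mem (natCast_mem F (n + 1))) (Int.cast_negSucc n)

/-- The associated graded algebra `⨁ p, F_p / F_{p-1}` is a `K`-algebra. -/
instance : DirectSum.GAlgebra K (Gr F) where
  toFun :=
    { toFun := fun k => Gr.mk F 0 (algebraMap K A k) (algebraMap_mem F k)
      map_zero' := Gr.mk_eq (hb := zero_mem _) (map_zero _)
      map_add' := fun k l => Gr.mk_eq (hb := add_mem (algebraMap_mem F k) (algebraMap_mem F l))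
        (map_add _ k l) }
  map_one := Gr.mk_eq (map_one _)
  map_mul k l := Gr.mk_congr (zero_add 0).symm (map_mul _ k l)
  commutes := by
    rintro k ⟨p, x⟩
    induction x using Gr.ind with
    | h a ha => exact Gr.mk_congr (add_comm 0 p) (Algebra.commutes k a)
  smul_def := by
    rintro k ⟨p, x⟩
    induction x using Gr.ind with
    | h a ha => exact Gr.mk_congr (ha := Submodule.smul_mem _ k ha) (zero_add p).symm
                  (Algebra.smul_def k a)

end GrAlgebra

/-! ### Leading homogeneous parts, and the general PBW property -/

section Graded

variable {K R : Type*} [Field K] [Ring R] [Algebra K R] (𝒜 : ℕ → Submodule K R)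

/-- The grading filtration `F_p R = ⨁_{i ≤ p} R_i`. -/
def gradingFil (p : ℕ) : Submodule K R := ⨆ i, ⨆ _ : i ≤ p, 𝒜 i

theorem gradingFil_mono : Monotone (gradingFil 𝒜) := by
  intro p q hpq
  exact iSup₂_le fun i hi => le_iSup₂_of_le i (hi.trans hpq) le_rfl

theorem mem_gradingFil {i p : ℕ} (h : i ≤ p) {a : R} (ha : a ∈ 𝒜 i) : a ∈ gradingFil 𝒜 p :=
  (le_iSup₂_of_le (f := fun i (_ : i ≤ p) => 𝒜 i) i h le_rfl) ha

variable [GradedAlgebra 𝒜]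

open Classical in
/-- The degree of `f ∈ R`: the largest `p` for which the homogeneous component of `f` of degree `p`
is nonzero; by convention the degree of `0` is `0`. -/
def deg (f : R) : ℕ := (DirectSum.decompose 𝒜 f).support.sup id

/-- The leading homogeneous part of `f`: its homogeneous component of degree `deg f`; in
particular the leading homogeneous part of `0` is `0`. -/
def LH (f : R) : R := DirectSum.decompose 𝒜 f (deg 𝒜 f)

instance : AlgFiltration (gradingFil 𝒜) where
  mono := gradingFil_mono 𝒜
  exhaustive a := by
    induction a using DirectSum.Decomposition.inductionOn 𝒜 with
    | zero => exact ⟨0, zero_mem _⟩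
    | @homogeneous i m => exact ⟨i, mem_gradingFil 𝒜 le_rfl m.2⟩
    | add a b ha hb =>
      obtain ⟨p, hp⟩ := ha
      obtain ⟨q, hq⟩ := hb
      exact ⟨max p q, add_mem (gradingFil_mono 𝒜 (le_max_left _ _) hp)
        (gradingFil_mono 𝒜 (le_max_right _ _) hq)⟩
  one_mem := mem_gradingFil 𝒜 le_rfl SetLike.GradedOne.one_mem
  mul_mem := by
    intro p q a b ha hb
    have h : gradingFil 𝒜 p * gradingFil 𝒜 q ≤ gradingFil 𝒜 (p + q) := by
      simp only [gradingFil, Submodule.iSup_mul, Submodule.mul_iSup]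
      refine iSup₂_le fun j hj => iSup₂_le fun i hi => Submodule.mul_le.2 fun a ha b hb => ?_
      exact mem_gradingFil 𝒜 (add_le_add hi hj) (SetLike.GradedMul.mul_mem ha hb)
    exact h (Submodule.mul_mem_mul ha hb)

theorem LH_mem (f : R) : LH 𝒜 f ∈ 𝒜 (deg 𝒜 f) := SetLike.coe_mem _

theorem sub_LH_mem (f : R) : f - LH 𝒜 f ∈ prev (gradingFil 𝒜) (deg 𝒜 f) := by
  classical
  have hle : ∀ i ∈ (DirectSum.decompose 𝒜 f).support, i ≤ deg 𝒜 f := fun i hi => by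
    have h : i ≤ (DirectSum.decompose 𝒜 f).support.sup id := Finset.le_sup (f := id) hi
    refine h.trans (le_of_eq ?_)
    unfold deg
    congr!
  have hsum : f - LH 𝒜 f = ∑ i ∈ (DirectSum.decompose 𝒜 f).support.erase (deg 𝒜 f),
      (DirectSum.decompose 𝒜 f i : R) := by
    by_cases h : deg 𝒜 f ∈ (DirectSum.decompose 𝒜 f).support
    · rw [sub_eq_iff_eq_add, LH, Finset.sum_erase_add _ _ h, DirectSum.sum_support_decompose]
    · rw [Finset.erase_eq_of_notMem h, DirectSum.sum_support_decompose, LH,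
        DFinsupp.notMem_support_iff.1 h]
      simp
  rw [hsum]
  refine sum_mem fun i hi => ?_
  rw [Finset.mem_erase] at hi
  exact le_prev (gradingFil_mono 𝒜) (lt_of_le_of_ne (hle i hi.2) hi.1)
    (mem_gradingFil 𝒜 le_rfl (SetLike.coe_mem _))

theorem mem_gradingFil_deg (f : R) : f ∈ gradingFil 𝒜 (deg 𝒜 f) := by
  have h := add_mem (prev_le (gradingFil_mono 𝒜) _ (sub_LH_mem 𝒜 f))
    (mem_gradingFil 𝒜 le_rfl (LH_mem 𝒜 f))
  rwa [sub_add_cancel] at h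

/-- The quotient filtration `F_p A = (F_p R + I) / I` on `A = R / I`. -/
def quotFil (I : TwoSidedIdeal R) (p : ℕ) : Submodule K (R ⧸ I.asIdeal) :=
  (gradingFil 𝒜 p).map (Ideal.Quotient.mkₐ K I.asIdeal).toLinearMap

instance (I : TwoSidedIdeal R) : AlgFiltration (quotFil 𝒜 I) where
  mono p q hpq := Submodule.map_mono (gradingFil_mono 𝒜 hpq)
  exhaustive a := by
    obtain ⟨r, rfl⟩ := Ideal.Quotient.mkₐ_surjective K I.asIdeal a
    obtain ⟨p, hp⟩ := AlgFiltration.exhaustive (F := gradingFil 𝒜) r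
    exact ⟨p, r, hp, rfl⟩
  one_mem := ⟨1, AlgFiltration.one_mem, map_one (Ideal.Quotient.mkₐ K I.asIdeal)⟩
  mul_mem := by
    rintro p q _ _ ⟨a, ha, rfl⟩ ⟨b, hb, rfl⟩
    exact ⟨a * b, AlgFiltration.mul_mem ha hb, map_mul (Ideal.Quotient.mkₐ K I.asIdeal) a b⟩

/-- The associated graded algebra `G(A)` of `A = R / I` with respect to the quotient filtration. -/
abbrev GrQuot (I : TwoSidedIdeal R) : Type _ := ⨁ p, Gr (quotFil 𝒜 I) p

/-- The natural graded map `φ : R → G(R / I)`, sending `r ∈ R_p` to the class of `r + I` in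
`F_p A / F_{p-1} A`. -/
def natGr (I : TwoSidedIdeal R) : R →ₗ[K] GrQuot 𝒜 I :=
  DirectSum.toModule K ℕ (GrQuot 𝒜 I) (fun p =>
    DirectSum.lof K ℕ (fun p => Gr (quotFil 𝒜 I) p) p ∘ₗ
      Gr.proj (quotFil 𝒜 I) p ∘ₗ
        (Ideal.Quotient.mkₐ K I.asIdeal).toLinearMap.restrict
          (fun _ hr => Submodule.mem_map_of_mem (mem_gradingFil 𝒜 le_rfl hr))) ∘ₗ
    (DirectSum.decomposeLinearEquiv 𝒜).toLinearMap

end Graded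

/-! ### The Shafarevich complex -/

section Shafarevich

variable (K R J : Type*) [Field K] [Ring R] [Algebra K R]

/-- With `U` the `K`-vector space with basis `X = {x_j}_{j ∈ J}`, the module
`Sh_n = R ⊗ U ⊗ R ⊗ ⋯ ⊗ U ⊗ R` with `n` factors `U` and `n + 1` factors `R`, all tensor products
over `K`. As `U` has basis `X`, this is the direct sum of copies of `R^{⊗ (n + 1)}` indexed by the
words `x_{j_1} ⋯ x_{j_n}`. -/
abbrev Sh (n : ℕ) : Type _ := (Fin n → J) →₀ ⨂[K] (_ : Fin (n + 1)), R

variable {R J}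

/-- The elementary tensor `a_0 ⊗ x_{w_0} ⊗ a_1 ⊗ ⋯ ⊗ a_{n-1} ⊗ x_{w_{n-1}} ⊗ a_n` in `Sh_n`. -/
def Sh.tensor {n : ℕ} (w : Fin n → J) (a : Fin (n + 1) → R) : Sh K R J n :=
  Finsupp.single w (PiTensorProduct.tprod K a)

variable {K}

theorem Sh.ind {n : ℕ} {P : Sh K R J n → Prop} (zero : P 0)
    (tensor : ∀ w a, P (Sh.tensor K w a)) (smul : ∀ (k : K) z, P z → P (k • z))
    (add : ∀ y z, P y → P z → P (y + z)) (z : Sh K R J n) : P z := by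
  induction z using Finsupp.induction_linear with
  | zero => exact zero
  | add y z hy hz => exact add y z hy hz
  | single w t =>
    induction t using PiTensorProduct.induction_on with
    | smul_tprod k a => simpa [Sh.tensor] using smul k _ (tensor w a)
    | add s t hs ht => rw [Finsupp.single_add]; exact add _ _ hs ht

/-- From `(a_0, …, a_{n+1})` form `(a_0, …, a_{i-1}, a_i c a_{i+1}, a_{i+2}, …, a_{n+1})`. -/
def contract {n : ℕ} (c : R) (i : Fin (n + 1)) (a : Fin (n + 2) → R) : Fin (n + 1) → R := fun k =>
  if k < i then a k.castSucc else if k = i then a i.castSucc * c * a i.succ else a k.succ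

theorem contract_self {n : ℕ} (c : R) (i : Fin (n + 1)) (a : Fin (n + 2) → R) :
    contract c i a i = a i.castSucc * c * a i.succ := by
  simp [contract]

theorem contract_ne {n : ℕ} (c : R) {i k : Fin (n + 1)} (h : k ≠ i) (a : Fin (n + 2) → R) :
    contract c i a k = a (i.castSucc.succAbove k) := by
  unfold contract
  rcases lt_or_gt_of_ne h with h' | h'
  · rw [if_pos h', Fin.succAbove_of_castSucc_lt _ _ (by simpa using h')]
  · rw [if_neg h'.not_gt, if_neg h, Fin.succAbove_of_le_castSucc _ _ (by simpa using h'.le)]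

theorem contract_update {n : ℕ} (c : R) (i : Fin (n + 1)) (a : Fin (n + 2) → R)
    (m : Fin (n + 2)) : ∃ (k : Fin (n + 1)) (g : R →ₗ[K] R), ∀ x,
      contract c i (Function.update a m x) = Function.update (contract c i a) k (g x) := by
  have key : ∀ k : Fin (n + 1), k ≠ i → i.castSucc.succAbove k ≠ i.castSucc ∧
      i.castSucc.succAbove k ≠ i.succ := fun k hk => by
    refine ⟨Fin.succAbove_ne _ _, fun h => hk ?_⟩
    rw [← Fin.succAbove_castSucc_self] at h
    exact Fin.succAbove_right_injective h
  have hne : i.castSucc ≠ i.succ := (Fin.castSucc_lt_succ).ne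
  by_cases hm : m = i.castSucc
  · subst hm
    refine ⟨i, LinearMap.mulRight K (c * a i.succ), fun x => funext fun k => ?_⟩
    by_cases hk : k = i
    · subst hk
      simp [contract_self, hne.symm, mul_assoc]
    · simp [contract_ne c hk, hk]
  by_cases hm' : m = i.succ
  · subst hm'
    refine ⟨i, LinearMap.mulLeft K (a i.castSucc * c), fun x => funext fun k => ?_⟩
    by_cases hk : k = i
    · subst hk
      simp [contract_self, hne, mul_assoc]
    · simp [contract_ne c hk, hk, (key k hk).2]
  obtain ⟨l, rfl⟩ := Fin.exists_succAbove_eq hm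
  have hl : l ≠ i := fun h => hm' (by rw [h, Fin.succAbove_castSucc_self])
  refine ⟨l, LinearMap.id, fun x => funext fun k => ?_⟩
  by_cases hk : k = i
  · subst hk
    simp [contract_self, hl.symm, (key l hl).1.symm, (key l hl).2.symm]
  · by_cases hkl : k = l
    · subst hkl
      simp [contract_ne c hk]
    · simp [contract_ne c hk, hkl]

variable (K)

/-- The linear map `a_0 ⊗ ⋯ ⊗ a_{n+1} ↦ a_0 ⊗ ⋯ ⊗ (a_i c a_{i+1}) ⊗ ⋯ ⊗ a_{n+1}`. -/
def contractMap {n : ℕ} (c : R) (i : Fin (n + 1)) :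
    (⨂[K] (_ : Fin (n + 2)), R) →ₗ[K] ⨂[K] (_ : Fin (n + 1)), R :=
  PiTensorProduct.lift
    (MultilinearMap.mk' (fun a => PiTensorProduct.tprod K (contract c i a))
      (fun a m x y => by
        obtain ⟨k, g, h⟩ := contract_update (K := K) c i a m
        simp only [h, map_add, MultilinearMap.map_update_add])
      (fun a m r x => by
        obtain ⟨k, g, h⟩ := contract_update (K := K) c i a m
        simp only [h, map_smul, MultilinearMap.map_update_smul]))

/-- The differential `d_{n+1} : Sh_{n+1} → Sh_n` of the Shafarevich complex `Sh(X | c, R)` of a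
family `c = {c_j}_{j ∈ J}` in `R`:
`d(a_0 ⊗ x_{w_0} ⊗ a_1 ⊗ ⋯ ⊗ x_{w_n} ⊗ a_{n+1}) =
  ∑ i, (-1)^i a_0 ⊗ x_{w_0} ⊗ ⋯ ⊗ (a_i c_{w_i} a_{i+1}) ⊗ ⋯ ⊗ x_{w_n} ⊗ a_{n+1}`,
the letter `x_{w_i}` being removed in the `i`-th summand, `0 ≤ i ≤ n`. -/
def shD (c : J → R) (n : ℕ) : Sh K R J (n + 1) →ₗ[K] Sh K R J n :=
  Finsupp.lsum K fun w => ∑ i : Fin (n + 1),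
    (-1 : K) ^ (i : ℕ) • (Finsupp.lsingle (i.removeNth w) ∘ₗ contractMap K (c (w i)) i)

variable {K}

theorem shD_tensor (c : J → R) {n : ℕ} (w : Fin (n + 1) → J) (a : Fin (n + 2) → R) :
    shD K c n (Sh.tensor K w a) = ∑ i : Fin (n + 1),
      (-1 : K) ^ (i : ℕ) • Sh.tensor K (i.removeNth w) (contract (c (w i)) i a) := by
  simp [shD, Sh.tensor, contractMap]

theorem contract_contract {n : ℕ} (c c' : R) {i j : Fin (n + 1)} (h : i ≤ j)
    (a : Fin (n + 3) → R) :
    contract c' j (contract c i.castSucc a) = contract c i (contract c' j.succ a) := by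
  funext k
  simp only [contract, Fin.lt_def, Fin.ext_iff, Fin.le_def, Fin.val_castSucc, Fin.val_succ] at h ⊢
  split_ifs <;> first | omega | rfl | skip
  obtain rfl : i = j := Fin.ext (by omega)
  simp only [mul_assoc, Fin.succ_castSucc]

theorem removeNth_removeNth {n : ℕ} {i j : Fin (n + 1)} (h : i ≤ j) (w : Fin (n + 2) → J) :
    j.removeNth (i.castSucc.removeNth w) = i.removeNth (j.succ.removeNth w) := by
  funext k
  simp only [Fin.removeNth]
  congr 1
  simp only [Fin.succAbove, Fin.lt_def, Fin.ext_iff, Fin.le_def] at h ⊢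
  split_ifs <;> simp_all <;> omega

/-- The Shafarevich complex is a complex. -/
theorem shD_shD (c : J → R) (n : ℕ) (z : Sh K R J (n + 2)) :
    shD K c n (shD K c (n + 1) z) = 0 := by
  induction z using Sh.ind with
  | zero => simp
  | smul k z h => simp [h]
  | add y z hy hz => simp [hy, hz]
  | tensor w a =>
    simp only [shD_tensor, map_sum, map_smul, Finset.smul_sum, smul_smul, ← pow_add]
    rw [← Finset.sum_product', Finset.univ_product_univ]
    let S : Finset (Fin (n + 2) × Fin (n + 1)) :=
      {ij : Fin (n + 2) × Fin (n + 1) | (ij.1 : ℕ) ≤ (ij.2 : ℕ)}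
    rw [← Finset.sum_add_sum_compl S, ← eq_neg_iff_add_eq_zero, ← Finset.sum_neg_distrib]
    let φ : ∀ ij : Fin (n + 2) × Fin (n + 1), ij ∈ S → Fin (n + 2) × Fin (n + 1) := fun ij hij =>
      (ij.2.succ, Fin.castLT ij.1 (lt_of_le_of_lt (Finset.mem_filter.mp hij).right ij.2.is_lt))
    apply Finset.sum_bij φ
    · intro ij hij
      simp only [S, φ, Finset.compl_filter, Finset.mem_filter_univ, Fin.val_succ,
        Fin.val_castLT] at hij ⊢
      omega
    · rintro ⟨i, j⟩ hij ⟨i', j'⟩ hij' h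
      simp only [φ, Prod.mk.injEq, Fin.ext_iff, Fin.val_succ, Fin.val_castLT] at h ⊢
      omega
    · rintro ⟨i', j'⟩ hij'
      simp only [S, Finset.compl_filter, Finset.mem_filter_univ, not_le] at hij'
      have hi : i' ≠ 0 := by rintro rfl; simp at hij'
      refine ⟨(j'.castSucc, i'.pred hi), ?_, ?_⟩
      · simp only [S, Finset.mem_filter_univ, Fin.val_castSucc, Fin.val_pred]
        omega
      · simp [φ]
    · rintro ⟨i, j⟩ hij
      simp only [S, Finset.mem_filter_univ] at hij
      obtain ⟨i, rfl⟩ : ∃ i' : Fin (n + 1), i = i'.castSucc :=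
        ⟨i.castLT (by omega), by simp⟩
      have hij' : i ≤ j := hij
      have e1 : i.castSucc.removeNth w j = w j.succ := by
        simp [Fin.removeNth, Fin.succAbove_of_le_castSucc _ _ (Fin.castSucc_le_castSucc_iff.2 hij')]
      have e2 : j.succ.removeNth w i = w i.castSucc := by
        simp [Fin.removeNth, Fin.succAbove_of_castSucc_lt _ _
          (lt_of_le_of_lt (Fin.castSucc_le_castSucc_iff.2 hij') Fin.castSucc_lt_succ)]
      simp only [φ, Fin.castLT_castSucc, e1, e2, removeNth_removeNth hij', contract_contract _ _ hij',
        Fin.val_castSucc, Fin.val_succ, ← neg_smul]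
      congr 1
      ring

/-! #### The bimodule structure -/

variable (K J)

/-- Left multiplication by `r ∈ R` on `Sh_n`. -/
def shLeft (r : R) (n : ℕ) : Sh K R J n →ₗ[K] Sh K R J n :=
  Finsupp.mapRange.linearMap
    (PiTensorProduct.map fun k => if k = 0 then LinearMap.mulLeft K r else LinearMap.id)

/-- Right multiplication by `r ∈ R` on `Sh_n`. -/
def shRight (r : R) (n : ℕ) : Sh K R J n →ₗ[K] Sh K R J n :=
  Finsupp.mapRange.linearMap
    (PiTensorProduct.map fun k => if k = Fin.last n then LinearMap.mulRight K r else LinearMap.id)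

variable {K J}

theorem shLeft_tensor (r : R) {n : ℕ} (w : Fin n → J) (a : Fin (n + 1) → R) :
    shLeft K J r n (Sh.tensor K w a) = Sh.tensor K w (Function.update a 0 (r * a 0)) := by
  simp only [shLeft, Sh.tensor, Finsupp.mapRange.linearMap_apply, Finsupp.mapRange_single,
    PiTensorProduct.map_tprod]
  congr 2
  funext k
  by_cases h : k = 0
  · subst h; simp
  · simp [h]

theorem shRight_tensor (r : R) {n : ℕ} (w : Fin n → J) (a : Fin (n + 1) → R) :
    shRight K J r n (Sh.tensor K w a) =
      Sh.tensor K w (Function.update a (Fin.last n) (a (Fin.last n) * r)) := by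
  simp only [shRight, Sh.tensor, Finsupp.mapRange.linearMap_apply, Finsupp.mapRange_single,
    PiTensorProduct.map_tprod]
  congr 2
  funext k
  by_cases h : k = Fin.last n
  · subst h; simp
  · simp [h]

theorem contract_update_zero {n : ℕ} (c r : R) (i : Fin (n + 1)) (a : Fin (n + 2) → R) :
    contract c i (Function.update a 0 (r * a 0)) =
      Function.update (contract c i a) 0 (r * contract c i a 0) := by
  funext k
  by_cases hk : k = i
  · subst hk
    rw [contract_self]
    by_cases h0 : k = 0
    · subst h0
      simp [contract_self, mul_assoc]
    · simp [h0, contract_self]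
  · rw [contract_ne c hk]
    by_cases h0 : k = 0
    · subst h0
      have : i.castSucc.succAbove 0 = 0 := Fin.succAbove_ne_zero_zero (by simpa using Ne.symm hk)
      simp [this, contract_ne c hk]
    · have : i.castSucc.succAbove k ≠ 0 := by
        rcases eq_or_ne i 0 with rfl | hi
        · exact Fin.succAbove_ne _ _
        · exact Fin.succAbove_ne_zero (by simpa using hi) h0
      simp [this, h0, contract_ne c hk]

theorem contract_update_last {n : ℕ} (c r : R) (i : Fin (n + 1)) (a : Fin (n + 2) → R) :
    contract c i (Function.update a (Fin.last (n + 1)) (a (Fin.last (n + 1)) * r)) =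
      Function.update (contract c i a) (Fin.last n) (contract c i a (Fin.last n) * r) := by
  funext k
  by_cases hk : k = i
  · subst hk
    rw [contract_self]
    have h1 : k.castSucc ≠ Fin.last (n + 1) := (Fin.castSucc_lt_last k).ne
    by_cases h0 : k = Fin.last n
    · subst h0
      simp [contract_self, mul_assoc, h1]
    · have h2 : k.succ ≠ Fin.last (n + 1) := by simpa [← Fin.succ_last] using h0
      simp [h0, contract_self, h1, h2]
  · rw [contract_ne c hk]
    by_cases h0 : k = Fin.last n
    · subst h0
      have : i.castSucc.succAbove (Fin.last n) = Fin.last (n + 1) :=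
        Fin.succAbove_ne_last_last (Fin.castSucc_lt_last i).ne
      simp [this, contract_ne c hk]
    · have : i.castSucc.succAbove k ≠ Fin.last (n + 1) :=
        Fin.succAbove_ne_last (Fin.castSucc_lt_last i).ne h0
      simp [this, h0, contract_ne c hk]

theorem shD_shLeft (c : J → R) (r : R) (n : ℕ) (z : Sh K R J (n + 1)) :
    shLeft K J r n (shD K c n z) = shD K c n (shLeft K J r (n + 1) z) := by
  induction z using Sh.ind with
  | zero => simp
  | tensor w a => simp only [shD_tensor, shLeft_tensor, map_sum, map_smul, contract_update_zero]
  | smul k z h => simp only [map_smul, h]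
  | add y z hy hz => simp only [map_add, hy, hz]

theorem shD_shRight (c : J → R) (r : R) (n : ℕ) (z : Sh K R J (n + 1)) :
    shRight K J r n (shD K c n z) = shD K c n (shRight K J r (n + 1) z) := by
  induction z using Sh.ind with
  | zero => simp
  | tensor w a => simp only [shD_tensor, shRight_tensor, map_sum, map_smul, contract_update_last]
  | smul k z h => simp only [map_smul, h]
  | add y z hy hz => simp only [map_add, hy, hz]

/-! #### Gradings and filtrations -/

section Degrees

variable (𝒜 : ℕ → Submodule K R) (e : J → ℕ)

/-- When `x_j` is given the degree `e_j`, the homogeneous part of degree `p` of `Sh_n`: the span of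
the elementary tensors with homogeneous entries `a_0, …, a_n` and letters `x_{w_0}, …, x_{w_{n-1}}`
whose degrees add up to `p`. -/
def shDeg (n p : ℕ) : Submodule K (Sh K R J n) :=
  Submodule.span K {z | ∃ (w : Fin n → J) (a : Fin (n + 1) → R) (q : Fin (n + 1) → ℕ),
    (∀ i, a i ∈ 𝒜 (q i)) ∧ ∑ i, q i + ∑ i, e (w i) = p ∧ z = Sh.tensor K w a}

/-- When `x_j` is given the degree `e_j`, the filtration term `F_p Sh_n`: the span of the
elementary tensors with homogeneous entries `a_0, …, a_n` and letters `x_{w_0}, …, x_{w_{n-1}}`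
whose degrees add up to at most `p`. -/
def shFil (n p : ℕ) : Submodule K (Sh K R J n) :=
  Submodule.span K {z | ∃ (w : Fin n → J) (a : Fin (n + 1) → R) (q : Fin (n + 1) → ℕ),
    (∀ i, a i ∈ 𝒜 (q i)) ∧ ∑ i, q i + ∑ i, e (w i) ≤ p ∧ z = Sh.tensor K w a}

theorem shFil_mono (n : ℕ) : Monotone (shFil 𝒜 e n) := by
  intro p q hpq
  refine Submodule.span_mono ?_
  rintro z ⟨w, a, d, ha, hd, rfl⟩
  exact ⟨w, a, d, ha, hd.trans hpq, rfl⟩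

theorem shDeg_le_shFil (n p : ℕ) : shDeg 𝒜 e n p ≤ shFil 𝒜 e n p := by
  refine Submodule.span_mono ?_
  rintro z ⟨w, a, d, ha, hd, rfl⟩
  exact ⟨w, a, d, ha, hd.le, rfl⟩

theorem sum_removeNth {n : ℕ} (i : Fin (n + 1)) (w : Fin (n + 1) → J) :
    ∑ k, e (w k) = e (w i) + ∑ k, e (i.removeNth w k) :=
  Fin.sum_univ_succAbove _ i

variable [GradedAlgebra 𝒜]

theorem contract_mem {n s : ℕ} {c : R} (hc : c ∈ 𝒜 s) (i : Fin (n + 1)) {a : Fin (n + 2) → R}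
    {q : Fin (n + 2) → ℕ} (ha : ∀ k, a k ∈ 𝒜 (q k)) :
    ∃ q' : Fin (n + 1) → ℕ, (∀ k, contract c i a k ∈ 𝒜 (q' k)) ∧ ∑ k, q' k = ∑ k, q k + s := by
  refine ⟨fun k => if k = i then q i.castSucc + s + q i.succ else q (i.castSucc.succAbove k),
    fun k => ?_, ?_⟩
  · by_cases hk : k = i
    · subst hk
      simpa [contract_self] using
        SetLike.mul_mem_graded (SetLike.mul_mem_graded (ha k.castSucc) hc) (ha k.succ)
    · simpa [contract_ne c hk, hk] using ha _
  · rw [Fin.sum_univ_succAbove _ i, Fin.sum_univ_succAbove q i.castSucc,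
      Fin.sum_univ_succAbove (fun k => q (i.castSucc.succAbove k)) i]
    simp only [if_true, Fin.succAbove_ne, if_false, Fin.succAbove_castSucc_self]
    ring

theorem shD_mem_shDeg {c : J → R} (hc : ∀ j, c j ∈ 𝒜 (e j)) (n p : ℕ) :
    ∀ z ∈ shDeg 𝒜 e (n + 1) p, shD K c n z ∈ shDeg 𝒜 e n p := by
  intro z hz
  refine (Submodule.span_le (p := (shDeg 𝒜 e n p).comap (shD K c n))).2 ?_ hz
  rintro _ ⟨w, a, q, ha, hq, rfl⟩
  rw [SetLike.mem_coe, Submodule.mem_comap, shD_tensor]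
  refine sum_mem fun i _ => Submodule.smul_mem _ _ ?_
  obtain ⟨q', hq', hs⟩ := contract_mem 𝒜 (hc (w i)) i ha
  refine Submodule.subset_span ⟨_, _, q', hq', ?_, rfl⟩
  rw [sum_removeNth e i w] at hq
  have hq₂ : ∑ k : Fin (n + 2), q k + (e (w i) + ∑ k, e (i.removeNth w k)) = p := hq
  omega

theorem tensor_contract_mem {n s p : ℕ} {c : R} (hc : c ∈ gradingFil 𝒜 s) (i : Fin (n + 1))
    {a : Fin (n + 2) → R} {q : Fin (n + 2) → ℕ} (ha : ∀ k, a k ∈ 𝒜 (q k)) (w : Fin n → J)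
    (h : ∑ k, q k + s + ∑ k, e (w k) ≤ p) : Sh.tensor K w (contract c i a) ∈ shFil 𝒜 e n p := by
  let L : R →ₗ[K] Sh K R J n := Finsupp.lsingle w ∘ₗ
    (PiTensorProduct.tprod K).toLinearMap (contract 0 i a) i ∘ₗ
      LinearMap.mulRight K (a i.succ) ∘ₗ LinearMap.mulLeft K (a i.castSucc)
  have hL : ∀ c, L c = Sh.tensor K w (contract c i a) := fun c => by
    simp only [L, Sh.tensor, LinearMap.comp_apply, MultilinearMap.toLinearMap_apply,
      Finsupp.lsingle_apply, LinearMap.mulRight_apply, LinearMap.mulLeft_apply]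
    congr 2
    funext k
    by_cases hk : k = i
    · subst hk; simp [contract_self]
    · simp [hk, contract_ne _ hk]
  rw [← hL]
  refine (iSup₂_le (a := (shFil 𝒜 e n p).comap L) fun l hl x hx => ?_ :
    gradingFil 𝒜 s ≤ (shFil 𝒜 e n p).comap L) hc
  rw [Submodule.mem_comap, hL]
  obtain ⟨q', hq', hs⟩ := contract_mem 𝒜 hx i ha
  exact Submodule.subset_span ⟨_, _, q', hq', by omega, rfl⟩

theorem tensor_contract_mem_prev {n s p : ℕ} {c : R} (hc : c ∈ prev (gradingFil 𝒜) s)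
    (i : Fin (n + 1)) {a : Fin (n + 2) → R} {q : Fin (n + 2) → ℕ} (ha : ∀ k, a k ∈ 𝒜 (q k))
    (w : Fin n → J) (h : ∑ k, q k + s + ∑ k, e (w k) ≤ p) :
    Sh.tensor K w (contract c i a) ∈ prev (shFil 𝒜 e n) p := by
  cases s with
  | zero =>
    have hc0 : c = 0 := hc
    have : PiTensorProduct.tprod K (contract c i a) = 0 :=
      (PiTensorProduct.tprod K).map_coord_zero i (by simp [contract_self, hc0])
    simp [Sh.tensor, this]
  | succ s =>
    cases p with
    | zero => omega
    | succ p => exact tensor_contract_mem 𝒜 e (s := s) (p := p) hc i ha w (by omega)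

theorem shD_mem_shFil {c : J → R} (hc : ∀ j, c j ∈ gradingFil 𝒜 (e j)) (n p : ℕ) :
    ∀ z ∈ shFil 𝒜 e (n + 1) p, shD K c n z ∈ shFil 𝒜 e n p := by
  intro z hz
  refine (Submodule.span_le (p := (shFil 𝒜 e n p).comap (shD K c n))).2 ?_ hz
  rintro _ ⟨w, a, q, ha, hq, rfl⟩
  rw [SetLike.mem_coe, Submodule.mem_comap, shD_tensor]
  refine sum_mem fun i _ => Submodule.smul_mem _ _ ?_
  rw [sum_removeNth e i w] at hq
  have hq₂ : ∑ k : Fin (n + 2), q k + (e (w i) + ∑ k, e (i.removeNth w k)) ≤ p := hq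
  exact tensor_contract_mem 𝒜 e (hc (w i)) i ha _ (by omega)

theorem contract_sub_tensor {n : ℕ} (c c' : R) (i : Fin (n + 1)) (a : Fin (n + 2) → R)
    (w : Fin n → J) : Sh.tensor K w (contract c i a) - Sh.tensor K w (contract c' i a) =
      Sh.tensor K w (contract (c - c') i a) := by
  have h : ∀ c, contract c i a =
      Function.update (contract 0 i a) i (a i.castSucc * c * a i.succ) := fun c => by
    funext k
    by_cases hk : k = i
    · subst hk; simp [contract_self]
    · simp [hk, contract_ne _ hk]
  rw [h c, h c', h (c - c'), mul_sub, sub_mul]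
  simp only [Sh.tensor, MultilinearMap.map_update_sub, Finsupp.single_sub]

theorem shD_sub_mem {c c' : J → R} (hc : ∀ j, c j - c' j ∈ prev (gradingFil 𝒜) (e j)) (n p : ℕ) :
    ∀ z ∈ shFil 𝒜 e (n + 1) p, shD K c n z - shD K c' n z ∈ prev (shFil 𝒜 e n) p := by
  intro z hz
  refine (Submodule.span_le
    (p := (prev (shFil 𝒜 e n) p).comap (shD K c n - shD K c' n))).2 ?_ hz
  rintro _ ⟨w, a, q, ha, hq, rfl⟩
  rw [SetLike.mem_coe, Submodule.mem_comap, LinearMap.sub_apply, shD_tensor, shD_tensor,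
    ← Finset.sum_sub_distrib]
  refine sum_mem fun i _ => ?_
  rw [← smul_sub, contract_sub_tensor]
  refine Submodule.smul_mem _ _ ?_
  rw [sum_removeNth e i w] at hq
  have hq₂ : ∑ k : Fin (n + 2), q k + (e (w i) + ∑ k, e (i.removeNth w k)) ≤ p := hq
  exact tensor_contract_mem_prev 𝒜 e (hc (w i)) i ha _ (by omega)

end Degrees

/-! #### Homology and extendable classes -/

section Extendable

variable (𝒜 : ℕ → Submodule K R) [GradedAlgebra 𝒜] (f : J → R)

/-- The degrees of the letters: `deg x_j = deg f_j = deg LH(f_j)`. -/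
abbrev degs : J → ℕ := fun j => deg 𝒜 (f j)

/-- The family `LH(F) = {LH(f_j)}_{j ∈ J}`. -/
abbrev LHs : J → R := fun j => LH 𝒜 (f j)

/-- The homology `H_{n+1}(Sh(X | c, R))`. -/
abbrev shHomology (c : J → R) (n : ℕ) : Type _ := Homology (shD K c (n + 1)) (shD K c n)

/-- Left multiplication by `r ∈ R` on `H_{n+1}(Sh(X | c, R))`. -/
def homologyLeft (c : J → R) (n : ℕ) (r : R) :
    shHomology (K := K) c n →ₗ[K] shHomology (K := K) c n :=
  Homology.map (shLeft K J r (n + 2)) (shLeft K J r (n + 1)) (shLeft K J r n)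
    (shD_shLeft c r (n + 1)) (shD_shLeft c r n)

/-- Right multiplication by `r ∈ R` on `H_{n+1}(Sh(X | c, R))`. -/
def homologyRight (c : J → R) (n : ℕ) (r : R) :
    shHomology (K := K) c n →ₗ[K] shHomology (K := K) c n :=
  Homology.map (shRight K J r (n + 2)) (shRight K J r (n + 1)) (shRight K J r n)
    (shD_shRight c r (n + 1)) (shD_shRight c r n)

/-- The sub-bimodule of `H_{n+1}(Sh(X | c, R))` generated by a set `S`: the smallest subspace that
contains `S` and is stable under left and right multiplication by the elements of `R`. -/
def bimoduleSpan (c : J → R) (n : ℕ) (S : Set (shHomology (K := K) c n)) :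
    Submodule K (shHomology (K := K) c n) :=
  sInf {N | S ⊆ N ∧ ∀ r : R, ∀ h ∈ N, homologyLeft c n r h ∈ N ∧ homologyRight c n r h ∈ N}

/-- The differential of the graded complex `Sh(X | LH(F), R)` in degree `p`,
`Sh_{n+1}(X | LH(F), R)_p → Sh_n(X | LH(F), R)_p`. -/
def leadD (n p : ℕ) :
    shDeg 𝒜 (degs 𝒜 f) (n + 1) p →ₗ[K] shDeg 𝒜 (degs 𝒜 f) n p :=
  (shD K (LHs 𝒜 f) n).restrict (shD_mem_shDeg 𝒜 _ (fun j => LH_mem 𝒜 (f j)) n p)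

theorem shD_filtered (n p : ℕ) : ∀ z ∈ shFil 𝒜 (degs 𝒜 f) (n + 1) p,
    shD K f n z ∈ shFil 𝒜 (degs 𝒜 f) n p :=
  shD_mem_shFil 𝒜 _ (fun j => mem_gradingFil_deg 𝒜 (f j)) n p

/-- The differential of the Rees complex of the filtered complex `Sh(X | F, R)` in degree `p`,
`F_p Sh_{n+1}(X | F, R) → F_p Sh_n(X | F, R)`. -/
def reesD (n p : ℕ) :
    shFil 𝒜 (degs 𝒜 f) (n + 1) p →ₗ[K] shFil 𝒜 (degs 𝒜 f) n p :=
  (shD K f n).restrict (shD_filtered 𝒜 f n p)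

/-- The differential of the associated graded complex of the filtered complex `Sh(X | F, R)` in
degree `p`. -/
def grD (n p : ℕ) :
    Gr (shFil 𝒜 (degs 𝒜 f) (n + 1)) p →ₗ[K] Gr (shFil 𝒜 (degs 𝒜 f) n) p :=
  Gr.map (shD K f n) (shD_filtered 𝒜 f n) p

/-- The natural map `φ : Sh_n(X | LH(F), R)_p → F_p Sh_n(X | F, R) / F_{p-1} Sh_n(X | F, R)`. -/
def phi (n p : ℕ) :
    shDeg 𝒜 (degs 𝒜 f) n p →ₗ[K] Gr (shFil 𝒜 (degs 𝒜 f) n) p :=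
  Gr.proj _ p ∘ₗ Submodule.inclusion (shDeg_le_shFil 𝒜 _ n p)

/-- The canonical map `ψ : F_p Sh_n(X | F, R) → F_p Sh_n(X | F, R) / F_{p-1} Sh_n(X | F, R)`. -/
def psi (n p : ℕ) :
    shFil 𝒜 (degs 𝒜 f) n p →ₗ[K] Gr (shFil 𝒜 (degs 𝒜 f) n) p :=
  Gr.proj _ p

theorem phi_comm (n p : ℕ) (z : shDeg 𝒜 (degs 𝒜 f) (n + 1) p) :
    phi 𝒜 f n p (leadD 𝒜 f n p z) = grD 𝒜 f n p (phi 𝒜 f (n + 1) p z) := by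
  have h := shD_sub_mem 𝒜 (degs 𝒜 f) (c := f) (c' := LHs 𝒜 f)
    (fun j => sub_LH_mem 𝒜 (f j)) n p z (shDeg_le_shFil 𝒜 _ (n + 1) p z.2)
  exact ((Gr.proj_eq_iff (F := shFil 𝒜 (degs 𝒜 f) n)
    ⟨shD K f n z, shD_filtered 𝒜 f n p z (shDeg_le_shFil 𝒜 _ (n + 1) p z.2)⟩
    ⟨shD K (LHs 𝒜 f) n z, shDeg_le_shFil 𝒜 _ n p (leadD 𝒜 f n p z).2⟩).2 h).symm

theorem psi_comm (n p : ℕ) (z : shFil 𝒜 (degs 𝒜 f) (n + 1) p) :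
    psi 𝒜 f n p (reesD 𝒜 f n p z) = grD 𝒜 f n p (psi 𝒜 f (n + 1) p z) := rfl

/-- The degree-`p` part of `H_{n+1}(Sh(X | LH(F), R))`. -/
abbrev leadHomology (n p : ℕ) : Type _ :=
  Homology (K := K) (A := shDeg 𝒜 (degs 𝒜 f) (n + 2) p) (B := shDeg 𝒜 (degs 𝒜 f) (n + 1) p)
    (C := shDeg 𝒜 (degs 𝒜 f) n p) (leadD 𝒜 f (n + 1) p) (leadD 𝒜 f n p)

/-- The degree-`p` part of `H_{n+1}` of the Rees complex of `Sh(X | F, R)`. -/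
abbrev reesHomology (n p : ℕ) : Type _ :=
  Homology (K := K) (A := shFil 𝒜 (degs 𝒜 f) (n + 2) p) (B := shFil 𝒜 (degs 𝒜 f) (n + 1) p)
    (C := shFil 𝒜 (degs 𝒜 f) n p) (reesD 𝒜 f (n + 1) p) (reesD 𝒜 f n p)

/-- The degree-`p` part of `H_{n+1}` of the associated graded complex of `Sh(X | F, R)`. -/
abbrev grHomology (n p : ℕ) : Type _ :=
  Homology (grD 𝒜 f (n + 1) p) (grD 𝒜 f n p)

/-- The degree-`p` part of `φ_*`, on `H_{n+1}`. -/
def phiStar (n p : ℕ) :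
    leadHomology 𝒜 f n p →ₗ[K]
      grHomology 𝒜 f n p :=
  Homology.map (phi 𝒜 f (n + 2) p) (phi 𝒜 f (n + 1) p) (phi 𝒜 f n p)
    (phi_comm 𝒜 f (n + 1) p) (phi_comm 𝒜 f n p)

/-- The degree-`p` part of `ψ_*`, on `H_{n+1}`. -/
def psiStar (n p : ℕ) :
    reesHomology 𝒜 f n p →ₗ[K]
      grHomology 𝒜 f n p :=
  Homology.map (psi 𝒜 f (n + 2) p) (psi 𝒜 f (n + 1) p) (psi 𝒜 f n p)
    (psi_comm 𝒜 f (n + 1) p) (psi_comm 𝒜 f n p)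

/-- The map `H_{n+1}(Sh(X | LH(F), R))_p → H_{n+1}(Sh(X | LH(F), R))` induced by the inclusion of
the degree-`p` part of the complex. -/
def homologyIncl (n p : ℕ) :
    leadHomology 𝒜 f n p →ₗ[K] shHomology (K := K) (LHs 𝒜 f) n :=
  Homology.map (Submodule.subtype _) (Submodule.subtype _) (Submodule.subtype _)
    (fun _ => rfl) (fun _ => rfl)

/-- The extendable classes of degree `p` in `H_{n+1}(Sh(X | LH(F), R))`: the degree-`p` part of
`φ_*⁻¹(Im ψ_*)`. -/
def extendable (n p : ℕ) : Submodule K (shHomology (K := K) (LHs 𝒜 f) n) :=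
  ((LinearMap.range (psiStar 𝒜 f n p)).comap (phiStar 𝒜 f n p)).map (homologyIncl 𝒜 f n p)

/-- `E_{n+1}(Sh(X | LH(F), R)) = φ_*⁻¹(Im ψ_*)`, the sum of its homogeneous parts. -/
def extendableHomology (n : ℕ) : Submodule K (shHomology (K := K) (LHs 𝒜 f) n) :=
  ⨆ p, extendable 𝒜 f n p

end Extendable

end Shafarevich

end PBW

/-!
Let `D` be a filtered map between graded modules whose leading part is the graded map `D₀`. Two
conditions are each equivalent to strictness of `D` (every element of degree at most `p` in the
image comes from an element of degree at most `p`): that every homogeneous element of `ker D₀` is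
the leading part of an element of `ker D`, and that the leading part of every element of `im D`
lies in `im D₀`. For the first differential `D = d : Sh₁(X | F, R) → Sh₀(X | F, R) = R` the leading
part is the differential of `Sh(X | LH(F), R)`. The first condition then says that every class of
`H₁(Sh(X | LH(F), R))` is a sum of extendable ones. In the second, `im D = ⟨F⟩` and
`im D₀ = ⟨LH(F)⟩`, so it says that `⟨LH(F)⟩` contains `LH(I)`. Moreover the kernel of the
surjection `R → G(A)` is always `⟨LH(I)⟩`, and the homogeneous parts of a multiple of an
extendable class are extendable, so the sums of extendable classes already form a bimodule.
-/

namespace PBW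

/-! ### Graded modules filtered by degree -/

section GradedModule

variable {K M N : Type*} [Semiring K] [AddCommMonoid M] [Module K M] [AddCommMonoid N] [Module K N]
  (𝓜 : ℕ → Submodule K M) (𝓝 : ℕ → Submodule K N)

/-- The term `⨁_{i ≤ p} 𝓜 i` of the filtration by degree of a graded module. For an algebra this is
`gradingFil`. -/
def degLE (p : ℕ) : Submodule K M := ⨆ i, ⨆ _ : i ≤ p, 𝓜 i

theorem degLE_mono : Monotone (degLE 𝓜) := fun _ _ hpq =>
  iSup₂_le fun i hi => le_iSup₂_of_le i (hi.trans hpq) le_rfl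

theorem le_degLE {i p : ℕ} (h : i ≤ p) : 𝓜 i ≤ degLE 𝓜 p := le_iSup₂_of_le i h le_rfl

variable {𝓜 𝓝} in
theorem map_mem_degLE_of_homogeneous {m : ℕ} {T : M →ₗ[K] N}
    (hT : ∀ p, ∀ x ∈ 𝓜 p, T x ∈ 𝓝 (p + m)) {p : ℕ} {x : M} (hx : x ∈ degLE 𝓜 p) :
    T x ∈ degLE 𝓝 (p + m) := by
  have hle : degLE 𝓜 p ≤ (degLE 𝓝 (p + m)).comap T := iSup₂_le fun i hi y hy =>
    le_degLE 𝓝 (Nat.add_le_add_right hi m) (hT i y hy)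
  exact hle hx

variable [DirectSum.Decomposition 𝓜] [DirectSum.Decomposition 𝓝]

/-- The projection of a graded module onto its homogeneous part of degree `p`, as an endomorphism
of the whole module. -/
def component (p : ℕ) : M →ₗ[K] M :=
  (𝓜 p).subtype ∘ₗ DirectSum.component K ℕ (fun i => 𝓜 i) p ∘ₗ
    (DirectSum.decomposeLinearEquiv 𝓜).toLinearMap

theorem component_apply (p : ℕ) (x : M) : component 𝓜 p x = DirectSum.decompose 𝓜 x p := rfl

theorem component_mem (p : ℕ) (x : M) : component 𝓜 p x ∈ 𝓜 p := SetLike.coe_mem _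

variable {𝓜}

theorem component_of_mem_same {p : ℕ} {x : M} (hx : x ∈ 𝓜 p) : component 𝓜 p x = x :=
  DirectSum.decompose_of_mem_same 𝓜 hx

theorem component_of_mem_ne {p q : ℕ} {x : M} (hx : x ∈ 𝓜 p) (h : p ≠ q) :
    component 𝓜 q x = 0 :=
  DirectSum.decompose_of_mem_ne 𝓜 hx h

theorem eq_zero_of_component_eq_zero {x : M} (h : ∀ p, component 𝓜 p x = 0) : x = 0 :=
  (DirectSum.decompose 𝓜).injective <| DFinsupp.ext fun p => Subtype.ext <| by
    rw [← component_apply, h p, DirectSum.decompose_zero, DirectSum.zero_apply,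
      ZeroMemClass.coe_zero]

theorem mem_degLE_iff {p : ℕ} {x : M} : x ∈ degLE 𝓜 p ↔ ∀ i, p < i → component 𝓜 i x = 0 := by
  classical
  refine ⟨fun hx i hi => ?_, fun h => ?_⟩
  · have hle : degLE 𝓜 p ≤ LinearMap.ker (component 𝓜 i) :=
      iSup₂_le fun j hj y hy => component_of_mem_ne hy (hj.trans_lt hi).ne
    exact hle hx
  · rw [← DirectSum.sum_support_decompose 𝓜 x]
    refine sum_mem fun i hi => le_degLE 𝓜 (not_lt.1 fun hpi => ?_) (SetLike.coe_mem _)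
    exact DFinsupp.mem_support_iff.1 hi (Subtype.ext (h i hpi))

theorem exists_mem_degLE (x : M) : ∃ p, x ∈ degLE 𝓜 p := by
  induction x using DirectSum.Decomposition.inductionOn 𝓜 with
  | zero => exact ⟨0, zero_mem _⟩
  | @homogeneous i m => exact ⟨i, le_degLE 𝓜 le_rfl m.2⟩
  | add x y hx hy =>
    obtain ⟨p, hp⟩ := hx
    obtain ⟨q, hq⟩ := hy
    exact ⟨max p q, add_mem (degLE_mono 𝓜 (le_max_left p q) hp)
      (degLE_mono 𝓜 (le_max_right p q) hq)⟩

theorem component_mem_of_mem_iSup {S : ℕ → Submodule K M} (hS : ∀ p, S p ≤ 𝓜 p) {x : M}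
    (hx : x ∈ ⨆ p, S p) (p : ℕ) : component 𝓜 p x ∈ S p := by
  suffices h : ⨆ q, S q ≤ (S p).comap (component 𝓜 p) from h hx
  refine iSup_le fun q y hy => ?_
  rw [Submodule.mem_comap]
  obtain rfl | hqp := eq_or_ne q p
  · rwa [component_of_mem_same (hS q hy)]
  · rw [component_of_mem_ne (hS q hy) hqp]
    exact zero_mem _

variable {𝓝}

theorem component_map_of_homogeneous {m : ℕ} {T : M →ₗ[K] N}
    (hT : ∀ p, ∀ x ∈ 𝓜 p, T x ∈ 𝓝 (p + m)) (p : ℕ) (x : M) :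
    component 𝓝 (p + m) (T x) = T (component 𝓜 p x) := by
  induction x using DirectSum.Decomposition.inductionOn 𝓜 with
  | zero => simp only [map_zero]
  | @homogeneous i y =>
    obtain rfl | hip := eq_or_ne i p
    · rw [component_of_mem_same y.2, component_of_mem_same (hT i y y.2)]
    · rw [component_of_mem_ne y.2 hip, map_zero, component_of_mem_ne (hT i y y.2) (by omega)]
  | add x y hx hy => simp only [map_add, hx, hy]

variable (𝓜)

/-- The homogeneous elements of degree `p` that are the leading parts of the elements of `S`: the
components of degree `p` of the elements of `S` of degree at most `p`. -/
def leadingParts (S : Submodule K M) (p : ℕ) : Submodule K M :=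
  (S ⊓ degLE 𝓜 p).map (component 𝓜 p)

theorem leadingParts_le (S : Submodule K M) (p : ℕ) : leadingParts 𝓜 S p ≤ 𝓜 p :=
  Submodule.map_le_iff_le_comap.2 fun x _ => component_mem 𝓜 p x

variable {𝓜}

theorem leadingParts_mono {S S' : Submodule K M} (h : S ≤ S') (p : ℕ) :
    leadingParts 𝓜 S p ≤ leadingParts 𝓜 S' p :=
  Submodule.map_mono (inf_le_inf_right _ h)

theorem map_mem_leadingParts {m : ℕ} {T : M →ₗ[K] N} (hT : ∀ p, ∀ x ∈ 𝓜 p, T x ∈ 𝓝 (p + m))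
    {S : Submodule K M} {S' : Submodule K N} (hS : S ≤ S'.comap T) {p : ℕ} {x : M}
    (hx : x ∈ leadingParts 𝓜 S p) : T x ∈ leadingParts 𝓝 S' (p + m) := by
  obtain ⟨y, ⟨hyS, hyp⟩, rfl⟩ := hx
  exact ⟨T y, ⟨hS hyS, map_mem_degLE_of_homogeneous hT hyp⟩, component_map_of_homogeneous hT p y⟩

end GradedModule

section Strictness

variable {K M N P : Type*} [Field K] [AddCommGroup M] [Module K M] [AddCommGroup N] [Module K N]
  [AddCommGroup P] [Module K P]

/-- A linear map `D` is strict for filtrations `F` and `G` if every element of its image that lies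
in `G p` is the image of an element of `F p`. -/
def IsStrict (F : ℕ → Submodule K M) (G : ℕ → Submodule K N) (D : M →ₗ[K] N) : Prop :=
  ∀ p, LinearMap.range D ⊓ G p ≤ (F p).map D

theorem isStrict_iff_prev {F : ℕ → Submodule K M} {G : ℕ → Submodule K N} {D : M →ₗ[K] N} :
    IsStrict F G D ↔ ∀ p, LinearMap.range D ⊓ prev G p ≤ (prev F p).map D := by
  refine ⟨fun h p => ?_, fun h p => h (p + 1)⟩
  cases p with
  | zero => exact inf_le_right.trans bot_le
  | succ p => exact h p

variable (𝓜 : ℕ → Submodule K M) (𝓝 : ℕ → Submodule K N) (𝓟 : ℕ → Submodule K P)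

/-- `D₀` is the leading part of the filtered map `D` between graded modules: it preserves degrees,
and `D` differs from it by terms of lower degree. -/
structure IsLeadingPart (D D₀ : M →ₗ[K] N) : Prop where
  map_mem : ∀ p, ∀ x ∈ 𝓜 p, D₀ x ∈ 𝓝 p
  sub_mem_prev : ∀ p, ∀ x ∈ 𝓜 p, D x - D₀ x ∈ prev (degLE 𝓝) p

variable {𝓜 𝓝 𝓟} {D D₀ : M →ₗ[K] N}

theorem map_mem_prev_degLE {T : M →ₗ[K] N} (hT : ∀ p, ∀ x ∈ 𝓜 p, T x ∈ 𝓝 p) {p : ℕ} {x : M}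
    (hx : x ∈ prev (degLE 𝓜) p) : T x ∈ prev (degLE 𝓝) p := by
  cases p with
  | zero => exact (Submodule.map_bot T).le ⟨x, hx, rfl⟩
  | succ p => exact map_mem_degLE_of_homogeneous (m := 0) hT hx

theorem IsLeadingPart.comp_left (h : IsLeadingPart 𝓜 𝓝 D D₀) {T : N →ₗ[K] P}
    (hT : ∀ p, ∀ x ∈ 𝓝 p, T x ∈ 𝓟 p) : IsLeadingPart 𝓜 𝓟 (T ∘ₗ D) (T ∘ₗ D₀) where
  map_mem p x hx := hT p _ (h.map_mem p x hx)
  sub_mem_prev p x hx := by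
    rw [LinearMap.comp_apply, LinearMap.comp_apply, ← map_sub]
    exact map_mem_prev_degLE hT (h.sub_mem_prev p x hx)

theorem IsLeadingPart.sub_mem_prev_of_mem_degLE (h : IsLeadingPart 𝓜 𝓝 D D₀) {p : ℕ} {x : M}
    (hx : x ∈ degLE 𝓜 p) : D x - D₀ x ∈ prev (degLE 𝓝) p := by
  have hle : degLE 𝓜 p ≤ (prev (degLE 𝓝) p).comap (D - D₀) := iSup₂_le fun i hi y hy =>
    prev_mono (degLE_mono 𝓝) hi (h.sub_mem_prev i y hy)
  exact hle hx

theorem IsLeadingPart.map_mem_degLE (h : IsLeadingPart 𝓜 𝓝 D D₀) {p : ℕ} {x : M}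
    (hx : x ∈ degLE 𝓜 p) : D x ∈ degLE 𝓝 p := by
  have hD₀ : D₀ x ∈ degLE 𝓝 p := map_mem_degLE_of_homogeneous (m := 0) h.map_mem hx
  have hsub := prev_le (degLE_mono 𝓝) p (h.sub_mem_prev_of_mem_degLE hx)
  simpa only [sub_add_cancel] using add_mem hsub hD₀

variable [DirectSum.Decomposition 𝓜]

theorem mem_prev_degLE_iff {p : ℕ} {x : M} :
    x ∈ prev (degLE 𝓜) p ↔ x ∈ degLE 𝓜 p ∧ component 𝓜 p x = 0 := by
  refine ⟨fun hx => ⟨prev_le (degLE_mono 𝓜) p hx, ?_⟩, fun ⟨hx, hp⟩ => ?_⟩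
  · cases p with
    | zero => rw [(Submodule.mem_bot K).1 hx, map_zero]
    | succ p => exact mem_degLE_iff.1 hx _ (Nat.lt_succ_self p)
  · rw [mem_degLE_iff] at hx
    have hge : ∀ i, p ≤ i → component 𝓜 i x = 0 := fun i hi =>
      hi.eq_or_lt.elim (fun hpi => hpi ▸ hp) (hx i)
    cases p with
    | zero => exact (Submodule.mem_bot K).2 (eq_zero_of_component_eq_zero fun i => hge i i.zero_le)
    | succ p => exact mem_degLE_iff.2 fun i hi => hge i hi

theorem sub_mem_prev_degLE_iff {p : ℕ} {x y : M} (hx : x ∈ degLE 𝓜 p) (hy : y ∈ degLE 𝓜 p) :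
    x - y ∈ prev (degLE 𝓜) p ↔ component 𝓜 p x = component 𝓜 p y := by
  rw [mem_prev_degLE_iff, map_sub, sub_eq_zero, and_iff_right (sub_mem hx hy)]

theorem sub_component_mem_prev_degLE {p : ℕ} {x : M} (hx : x ∈ degLE 𝓜 p) :
    x - component 𝓜 p x ∈ prev (degLE 𝓜) p := by
  rw [sub_mem_prev_degLE_iff hx (le_degLE 𝓜 le_rfl (component_mem 𝓜 p x)),
    component_of_mem_same (component_mem 𝓜 p x)]

theorem IsLeadingPart.ker_le_of_isStrict (h : IsLeadingPart 𝓜 𝓝 D D₀)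
    (hD : IsStrict (degLE 𝓜) (degLE 𝓝) D) (p : ℕ) :
    LinearMap.ker D₀ ⊓ 𝓜 p ≤ leadingParts 𝓜 (LinearMap.ker D) p := by
  rintro x ⟨hx₀, hx⟩
  have hDx : D x ∈ prev (degLE 𝓝) p := by
    simpa only [LinearMap.mem_ker.1 hx₀, sub_zero] using h.sub_mem_prev p x hx
  obtain ⟨y, hy, hyx⟩ := isStrict_iff_prev.1 hD p ⟨⟨x, rfl⟩, hDx⟩
  obtain ⟨hyp, hy₀⟩ := mem_prev_degLE_iff.1 hy
  exact ⟨x - y, ⟨LinearMap.sub_mem_ker_iff.2 hyx.symm, sub_mem (le_degLE 𝓜 le_rfl hx) hyp⟩,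
    by rw [map_sub, hy₀, sub_zero, component_of_mem_same hx]⟩

variable [DirectSum.Decomposition 𝓝]

namespace IsLeadingPart

theorem component_map (h : IsLeadingPart 𝓜 𝓝 D D₀) {p : ℕ} {x : M} (hx : x ∈ degLE 𝓜 p) :
    component 𝓝 p (D x) = D₀ (component 𝓜 p x) := by
  have hD₀ : D₀ x ∈ degLE 𝓝 p := map_mem_degLE_of_homogeneous (m := 0) h.map_mem hx
  rw [(sub_mem_prev_degLE_iff (h.map_mem_degLE hx) hD₀).1 (h.sub_mem_prev_of_mem_degLE hx)]
  exact component_map_of_homogeneous (m := 0) h.map_mem p x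

theorem isStrict_of_ker_le (h : IsLeadingPart 𝓜 𝓝 D D₀)
    (hker : ∀ p, LinearMap.ker D₀ ⊓ 𝓜 p ≤ leadingParts 𝓜 (LinearMap.ker D) p) :
    IsStrict (degLE 𝓜) (degLE 𝓝) D := by
  rintro p _ ⟨⟨x, rfl⟩, hDx⟩
  obtain ⟨q, hxq⟩ := exists_mem_degLE (𝓜 := 𝓜) x
  induction q generalizing x with
  | zero => exact ⟨x, degLE_mono 𝓜 p.zero_le hxq, rfl⟩
  | succ q ih =>
    obtain hqp | hpq := le_or_gt (q + 1) p
    · exact ⟨x, degLE_mono 𝓜 hqp hxq, rfl⟩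
    have hlead : component 𝓜 (q + 1) x ∈ LinearMap.ker D₀ := by
      rw [LinearMap.mem_ker, ← h.component_map hxq, mem_degLE_iff.1 hDx _ hpq]
    obtain ⟨z, ⟨hDz, hzq⟩, hzx⟩ := hker (q + 1) ⟨hlead, component_mem 𝓜 (q + 1) x⟩
    have hD : D (x - z) = D x := by rw [map_sub, LinearMap.mem_ker.1 hDz, sub_zero]
    rw [← hD]
    exact ih (x - z) (hD.symm ▸ hDx) ((sub_mem_prev_degLE_iff hxq hzq).2 hzx.symm)

theorem ker_le_leadingParts_iff_isStrict (h : IsLeadingPart 𝓜 𝓝 D D₀) :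
    (∀ p, LinearMap.ker D₀ ⊓ 𝓜 p ≤ leadingParts 𝓜 (LinearMap.ker D) p) ↔
      IsStrict (degLE 𝓜) (degLE 𝓝) D :=
  ⟨h.isStrict_of_ker_le, h.ker_le_of_isStrict⟩

theorem leadingParts_range_le_of_isStrict (h : IsLeadingPart 𝓜 𝓝 D D₀)
    (hD : IsStrict (degLE 𝓜) (degLE 𝓝) D) (p : ℕ) :
    leadingParts 𝓝 (LinearMap.range D) p ≤ LinearMap.range D₀ := by
  rintro _ ⟨u, hu, rfl⟩
  obtain ⟨x, hx, rfl⟩ := hD p hu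
  exact ⟨component 𝓜 p x, (h.component_map hx).symm⟩

theorem isStrict_of_leadingParts_range_le (h : IsLeadingPart 𝓜 𝓝 D D₀)
    (hrange : ∀ p, leadingParts 𝓝 (LinearMap.range D) p ≤ LinearMap.range D₀) :
    IsStrict (degLE 𝓜) (degLE 𝓝) D := by
  refine isStrict_iff_prev.2 fun p => ?_
  induction p with
  | zero => exact inf_le_right.trans bot_le
  | succ p ih =>
    rintro u ⟨hu, hup⟩
    obtain ⟨x, hx⟩ := hrange p ⟨u, ⟨hu, hup⟩, rfl⟩
    have hxp : component 𝓜 p x ∈ degLE 𝓜 p := le_degLE 𝓜 le_rfl (component_mem 𝓜 p x)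
    have hlead : component 𝓝 p u = component 𝓝 p (D (component 𝓜 p x)) := by
      rw [h.component_map hxp, component_of_mem_same (component_mem 𝓜 p x),
        ← component_map_of_homogeneous (m := 0) h.map_mem p x, hx]
      exact (component_of_mem_same (component_mem 𝓝 p u)).symm
    obtain ⟨y, hy, hDy⟩ := ih ⟨sub_mem hu ⟨_, rfl⟩,
      (sub_mem_prev_degLE_iff hup (h.map_mem_degLE hxp)).2 hlead⟩
    exact ⟨y + component 𝓜 p x, add_mem (prev_le (degLE_mono 𝓜) p hy) hxp,
      by rw [map_add, hDy, sub_add_cancel]⟩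

theorem isStrict_iff_leadingParts_range_le (h : IsLeadingPart 𝓜 𝓝 D D₀) :
    IsStrict (degLE 𝓜) (degLE 𝓝) D ↔
      ∀ p, leadingParts 𝓝 (LinearMap.range D) p ≤ LinearMap.range D₀ :=
  ⟨h.leadingParts_range_le_of_isStrict, h.isStrict_of_leadingParts_range_le⟩

theorem range_inf_le (h : IsLeadingPart 𝓜 𝓝 D D₀) (p : ℕ) :
    LinearMap.range D₀ ⊓ 𝓝 p ≤ leadingParts 𝓝 (LinearMap.range D) p := by
  rintro _ ⟨⟨u, rfl⟩, hu⟩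
  have hup : component 𝓜 p u ∈ degLE 𝓜 p := le_degLE 𝓜 le_rfl (component_mem 𝓜 p u)
  refine ⟨D (component 𝓜 p u), ⟨⟨_, rfl⟩, h.map_mem_degLE hup⟩, ?_⟩
  rw [h.component_map hup, component_of_mem_same (component_mem 𝓜 p u),
    ← component_map_of_homogeneous (m := 0) h.map_mem p u]
  exact component_of_mem_same hu

end IsLeadingPart

end Strictness

section GradedSubspaces

variable {K M : Type*} [Ring K] [AddCommGroup M] [Module K M] {𝓜 : ℕ → Submodule K M}
  [DirectSum.Decomposition 𝓜]

theorem comap_subtype_le_iSup_iff {Z B : Submodule K M} (hBZ : B ≤ Z)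
    (hB : ∀ p, ∀ x ∈ B, component 𝓜 p x ∈ B) {S : ℕ → Submodule K M} (hS : ∀ p, S p ≤ 𝓜 p) :
    B.comap Z.subtype ≤ ⨆ p, (S p).comap Z.subtype ↔ ∀ p, B ⊓ 𝓜 p ≤ S p := by
  classical
  refine ⟨fun h p x ⟨hxB, hxp⟩ => ?_, fun h x hxB => ?_⟩
  · have hle : ⨆ p, (S p).comap Z.subtype ≤ (⨆ p, S p).comap Z.subtype :=
      iSup_le fun p => Submodule.comap_mono (le_iSup S p)
    have hxS : x ∈ ⨆ p, S p := hle (h (show ⟨x, hBZ hxB⟩ ∈ B.comap Z.subtype from hxB))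
    exact component_of_mem_same hxp ▸ component_mem_of_mem_iSup hS hxS p
  · have hx : x = ∑ p ∈ (DirectSum.decompose 𝓜 x.1).support,
        (⟨component 𝓜 p x, hBZ (hB p x hxB)⟩ : Z) := Subtype.ext <| by
      rw [AddSubmonoidClass.coe_finsetSum]
      exact (DirectSum.sum_support_decompose 𝓜 x.1).symm
    rw [hx]
    exact sum_mem fun p _ => Submodule.mem_iSup_of_mem p (h p ⟨hB p x hxB, component_mem 𝓜 p x⟩)

end GradedSubspaces

/-! ### The grading of the Shafarevich complex -/

section ShafarevichGrading

theorem multilinearMap_ext_of_homogeneous {ι K R N : Type*} [Finite ι] [Semiring K]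
    [AddCommMonoid R] [Module K R] [AddCommMonoid N] [Module K N] (𝒜 : ℕ → Submodule K R)
    [DirectSum.Decomposition 𝒜] {g g' : MultilinearMap K (fun _ : ι => R) N}
    (h : ∀ (a : ι → R) (q : ι → ℕ), (∀ i, a i ∈ 𝒜 (q i)) → g a = g' a) : g = g' := by
  have hcoe : g.compLinearMap (fun _ => DirectSum.coeLinearMap 𝒜) =
      g'.compLinearMap (fun _ => DirectSum.coeLinearMap 𝒜) := by
    refine MultilinearMap.dfinsupp_ext fun q => MultilinearMap.ext fun a => ?_
    refine h _ q fun i => ?_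
    change DirectSum.coeLinearMap 𝒜 (DirectSum.lof K ℕ (fun j => 𝒜 j) (q i) (a i)) ∈ 𝒜 (q i)
    rw [DirectSum.coeLinearMap_lof]
    exact (a i).2
  refine MultilinearMap.ext fun a => ?_
  have ha := DFunLike.congr_fun hcoe fun i => DirectSum.decompose 𝒜 (a i)
  have hd : ∀ r, DirectSum.coeLinearMap 𝒜 (DirectSum.decompose 𝒜 r) = r :=
    (DirectSum.decompose 𝒜).symm_apply_apply
  simpa only [MultilinearMap.compLinearMap_apply, hd] using ha

variable {K R J : Type*} [Field K] [Ring R] [Algebra K R] (𝒜 : ℕ → Submodule K R) (e : J → ℕ)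

theorem Sh.hom_ext_of_homogeneous [DirectSum.Decomposition 𝒜] {N : Type*} [AddCommMonoid N]
    [Module K N] {n : ℕ} {T T' : Sh K R J n →ₗ[K] N}
    (h : ∀ (w : Fin n → J) (a : Fin (n + 1) → R) (q : Fin (n + 1) → ℕ), (∀ i, a i ∈ 𝒜 (q i)) →
      T (Sh.tensor K w a) = T' (Sh.tensor K w a)) : T = T' :=
  Finsupp.lhom_ext' fun w => PiTensorProduct.ext <|
    multilinearMap_ext_of_homogeneous 𝒜 fun a q ha => h w a q ha

variable {𝒜}

theorem Sh.tensor_mem_shDeg {n p : ℕ} {a : Fin (n + 1) → R} {q : Fin (n + 1) → ℕ}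
    (ha : ∀ i, a i ∈ 𝒜 (q i)) (w : Fin n → J) (hp : ∑ i, q i + ∑ i, e (w i) = p) :
    Sh.tensor K w a ∈ shDeg 𝒜 e n p :=
  Submodule.subset_span ⟨w, a, q, ha, hp, rfl⟩

variable (𝒜)

theorem shFil_eq_degLE (n : ℕ) : shFil (K := K) 𝒜 e n = degLE (shDeg 𝒜 e n) := by
  funext p
  refine le_antisymm (Submodule.span_le.2 ?_) (iSup₂_le fun i hi => ?_)
  · rintro _ ⟨w, a, q, ha, hp, rfl⟩
    exact le_degLE _ hp (Sh.tensor_mem_shDeg e ha w rfl)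
  · exact (shDeg_le_shFil 𝒜 e n i).trans (shFil_mono 𝒜 e n hi)

theorem isLeadingPart_shD [GradedAlgebra 𝒜] {c c₀ : J → R} (hc₀ : ∀ j, c₀ j ∈ 𝒜 (e j))
    (hc : ∀ j, c j - c₀ j ∈ prev (gradingFil 𝒜) (e j)) (n : ℕ) :
    IsLeadingPart (shDeg 𝒜 e (n + 1)) (shDeg 𝒜 e n) (shD K c n) (shD K c₀ n) where
  map_mem := shD_mem_shDeg 𝒜 e hc₀ n
  sub_mem_prev p z hz := by
    rw [← shFil_eq_degLE]
    exact shD_sub_mem 𝒜 e hc n p z (shDeg_le_shFil 𝒜 e (n + 1) p hz)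

/-- The elementary tensor on a word `w`, as a multilinear map on homogeneous entries of prescribed
degrees `q` with values in the homogeneous part of `Sh` of degree `∑ q + ∑ e (w i)`. -/
def homogeneousTensor {n : ℕ} (w : Fin n → J) (q : Fin (n + 1) → ℕ) :
    MultilinearMap K (fun i => 𝒜 (q i)) (shDeg 𝒜 e n (∑ i, q i + ∑ i, e (w i))) :=
  (((Finsupp.lsingle w).compMultilinearMap (PiTensorProduct.tprod K)).compLinearMap
    fun i => (𝒜 (q i)).subtype).codRestrict _
      fun a => Sh.tensor_mem_shDeg e (fun i => (a i).2) w rfl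

variable [DirectSum.Decomposition 𝒜]

/-- The decomposition of `Sh n` into homogeneous parts: an elementary tensor is expanded over the
homogeneous components of its entries. -/
def shDecompose (n : ℕ) : Sh K R J n →ₗ[K] ⨁ p, shDeg 𝒜 e n p :=
  Finsupp.lsum K fun w => PiTensorProduct.lift <|
    (DirectSum.toModule K (Fin (n + 1) → ℕ) (⨁ p, shDeg 𝒜 e n p) fun q =>
      DirectSum.lof K ℕ (fun p => shDeg 𝒜 e n p) (∑ i, q i + ∑ i, e (w i))).compMultilinearMap
    ((MultilinearMap.dfinsuppFamily (homogeneousTensor 𝒜 e w)).compLinearMap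
      fun _ => (DirectSum.decomposeLinearEquiv 𝒜).toLinearMap)

variable {𝒜}

theorem shDecompose_tensor {n p : ℕ} {a : Fin (n + 1) → R} {q : Fin (n + 1) → ℕ}
    (ha : ∀ i, a i ∈ 𝒜 (q i)) (w : Fin n → J) (hp : ∑ i, q i + ∑ i, e (w i) = p) :
    shDecompose 𝒜 e n (Sh.tensor K w a) =
      DirectSum.lof K ℕ (fun p => shDeg 𝒜 e n p) p
        ⟨Sh.tensor K w a, Sh.tensor_mem_shDeg e ha w hp⟩ := by
  subst hp
  have hdec : (fun i => DirectSum.decompose 𝒜 (a i)) =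
      fun i => DFinsupp.single (q i) (⟨a i, ha i⟩ : 𝒜 (q i)) :=
    funext fun i => DirectSum.decompose_of_mem 𝒜 (ha i)
  simp only [shDecompose, Sh.tensor, Finsupp.lsum_single, PiTensorProduct.lift.tprod,
    LinearMap.compMultilinearMap_apply, MultilinearMap.compLinearMap_apply]
  refine (congrArg _ (congrArg _ hdec)).trans ?_
  rw [MultilinearMap.dfinsuppFamily_single]
  exact DirectSum.toModule_lof K q _

theorem shDecompose_of_mem {n p : ℕ} {z : Sh K R J n} (hz : z ∈ shDeg 𝒜 e n p) :
    shDecompose 𝒜 e n z = DirectSum.lof K ℕ (fun p => shDeg 𝒜 e n p) p ⟨z, hz⟩ := by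
  induction hz using Submodule.span_induction with
  | mem z hz =>
    obtain ⟨w, a, q, ha, hp, rfl⟩ := hz
    exact shDecompose_tensor e ha w hp
  | zero => rw [map_zero, ← map_zero (DirectSum.lof K ℕ (fun p => shDeg 𝒜 e n p) p)]; rfl
  | add y z hy hz ihy ihz => rw [map_add, ihy, ihz, ← map_add]; rfl
  | smul k z hz ih => rw [map_smul, ih, ← map_smul]; rfl

variable (𝒜)

instance shDecomposition (n : ℕ) :
    DirectSum.Decomposition (fun p => shDeg (K := K) 𝒜 e n p) :=
  DirectSum.Decomposition.ofLinearMap _ (shDecompose 𝒜 e n)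
    (Sh.hom_ext_of_homogeneous 𝒜 fun w a q ha => by
      rw [LinearMap.comp_apply, shDecompose_tensor e ha w rfl, DirectSum.coeLinearMap_lof]
      rfl)
    (DirectSum.linearMap_ext K fun p => LinearMap.ext fun z => by
      rw [LinearMap.comp_apply, LinearMap.comp_apply, DirectSum.coeLinearMap_lof]
      exact shDecompose_of_mem e z.2)

end ShafarevichGrading

/-! ### Extendable classes -/

section Homology

variable {K A B C A' B' C' A'' B'' C'' : Type*} [Field K] [AddCommGroup A]
  [Module K A] [AddCommGroup B] [Module K B] [AddCommGroup C] [Module K C] [AddCommGroup A']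
  [Module K A'] [AddCommGroup B'] [Module K B'] [AddCommGroup C'] [Module K C']
  [AddCommGroup A''] [Module K A''] [AddCommGroup B''] [Module K B''] [AddCommGroup C'']
  [Module K C''] {f : A →ₗ[K] B} {g : B →ₗ[K] C} {f' : A' →ₗ[K] B'} {g' : B' →ₗ[K] C'}
  {f'' : A'' →ₗ[K] B''} {g'' : B'' →ₗ[K] C''} {α : A →ₗ[K] A''} {β : B →ₗ[K] B''}
  {γ : C →ₗ[K] C''} {α' : A' →ₗ[K] A''} {β' : B' →ₗ[K] B''} {γ' : C' →ₗ[K] C''}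
  {h₁ : ∀ x, β (f x) = f'' (α x)} {h₂ : ∀ y, γ (g y) = g'' (β y)}
  {h₁' : ∀ x, β' (f' x) = f'' (α' x)} {h₂' : ∀ y, γ' (g' y) = g'' (β' y)}

/-- The homology class of a cycle. -/
def Homology.mk (f : A →ₗ[K] B) (g : B →ₗ[K] C) (z : LinearMap.ker g) : Homology f g :=
  Submodule.Quotient.mk z

theorem Homology.mk_surjective (f : A →ₗ[K] B) (g : B →ₗ[K] C) :
    Function.Surjective (Homology.mk f g) :=
  Submodule.Quotient.mk_surjective _

theorem Homology.map_mk_eq_map_mk_iff (z : LinearMap.ker g) (z' : LinearMap.ker g') :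
    Homology.map α β γ h₁ h₂ (Homology.mk f g z) =
        Homology.map α' β' γ' h₁' h₂' (Homology.mk f' g' z') ↔
      ∃ x, f'' x = β z - β' z' :=
  Submodule.Quotient.eq _

end Homology

section Extendable

variable {K R J : Type*} [Field K] [Ring R] [Algebra K R] (𝒜 : ℕ → Submodule K R) [GradedAlgebra 𝒜]
  (f : J → R)

theorem isLeadingPart_shD_LHs (n : ℕ) :
    IsLeadingPart (shDeg 𝒜 (degs 𝒜 f) (n + 1)) (shDeg 𝒜 (degs 𝒜 f) n) (shD K f n)
      (shD K (LHs 𝒜 f) n) :=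
  isLeadingPart_shD 𝒜 (degs 𝒜 f) (fun j => LH_mem 𝒜 (f j)) (fun j => sub_LH_mem 𝒜 (f j)) n

variable {𝒜 f}

theorem phi_eq_psi_iff {n p : ℕ} (z : shDeg 𝒜 (degs 𝒜 f) n p) {y : Sh K R J n}
    (hy : y ∈ shFil 𝒜 (degs 𝒜 f) n p) :
    phi 𝒜 f n p z = psi 𝒜 f n p ⟨y, hy⟩ ↔ component (shDeg 𝒜 (degs 𝒜 f) n) p y = z := by
  refine (Gr.proj_eq_iff (F := shFil 𝒜 (degs 𝒜 f) n)
    ⟨z, shDeg_le_shFil 𝒜 _ n p z.2⟩ ⟨y, hy⟩).trans ?_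
  change z.1 - y ∈ prev (shFil 𝒜 (degs 𝒜 f) n) p ↔ _
  rw [shFil_eq_degLE] at hy ⊢
  rw [sub_mem_prev_degLE_iff (le_degLE _ le_rfl z.2) hy, component_of_mem_same z.2, eq_comm]

theorem mem_extendable_iff {n p : ℕ} {h : shHomology (K := K) (LHs 𝒜 f) n} :
    h ∈ extendable 𝒜 f n p ↔ ∃ z : LinearMap.ker (shD K (LHs 𝒜 f) n),
      z.1 ∈ leadingParts (shDeg 𝒜 (degs 𝒜 f) (n + 1)) (LinearMap.ker (shD K f n)) p ∧
        Homology.mk _ _ z = h := by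
  constructor
  · rintro ⟨x, ⟨t, ht⟩, rfl⟩
    obtain ⟨z, rfl⟩ := Homology.mk_surjective _ _ x
    obtain ⟨y, rfl⟩ := Homology.mk_surjective _ _ t
    obtain ⟨u, hu⟩ := (Homology.map_mk_eq_map_mk_iff _ _).1 ht
    obtain ⟨v, rfl⟩ := Submodule.Quotient.mk_surjective _ u
    have hlead : phi 𝒜 f (n + 1) p z.1 =
        psi 𝒜 f (n + 1) p y.1 - psi 𝒜 f (n + 1) p (reesD 𝒜 f (n + 1) p v) := by
      rw [eq_sub_iff_add_eq', ← eq_sub_iff_add_eq]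
      exact hu
    refine ⟨⟨z.1, congrArg Subtype.val z.2⟩, ?_, rfl⟩
    refine ⟨_, ⟨?_, ?_⟩, (phi_eq_psi_iff z.1 _).1 (hlead.trans (map_sub _ _ _).symm)⟩
    · change shD K f n (y.1.1 - shD K f (n + 1) v.1) = 0
      rw [map_sub, shD_shD, sub_zero]
      exact congrArg Subtype.val y.2
    · exact (shFil_eq_degLE 𝒜 (degs 𝒜 f) (n + 1)).le p (y.1 - reesD 𝒜 f (n + 1) p v).2
  · rintro ⟨⟨_, hz⟩, ⟨y, ⟨hy, hyp⟩, rfl⟩, rfl⟩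
    rw [← shFil_eq_degLE] at hyp
    let z : shDeg 𝒜 (degs 𝒜 f) (n + 1) p := ⟨_, component_mem _ p y⟩
    refine ⟨Homology.mk _ _ ⟨z, Subtype.ext hz⟩,
      ⟨Homology.mk _ _ ⟨⟨y, hyp⟩, Subtype.ext hy⟩, ?_⟩, rfl⟩
    refine (Homology.map_mk_eq_map_mk_iff _ _).2 ⟨0, ?_⟩
    rw [map_zero, (phi_eq_psi_iff z hyp).2 rfl, sub_self]

variable (𝒜 f)

theorem extendableHomology_eq_map (n : ℕ) :
    extendableHomology 𝒜 f n =
      (⨆ p, (leadingParts (shDeg 𝒜 (degs 𝒜 f) (n + 1)) (LinearMap.ker (shD K f n)) p).comap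
        (LinearMap.ker (shD K (LHs 𝒜 f) n)).subtype).map (Submodule.mkQ _) := by
  rw [Submodule.map_iSup]
  exact iSup_congr fun p => Submodule.ext fun _ => mem_extendable_iff

theorem extendableHomology_eq_top_iff_isStrict (n : ℕ) :
    extendableHomology 𝒜 f n = ⊤ ↔
      IsStrict (degLE (shDeg 𝒜 (degs 𝒜 f) (n + 1))) (degLE (shDeg 𝒜 (degs 𝒜 f) n))
        (shD K f n) := by
  have hD := isLeadingPart_shD_LHs 𝒜 f n
  have hD' := isLeadingPart_shD_LHs 𝒜 f (n + 1)
  have hbound : LinearMap.range (shD K (LHs 𝒜 f) (n + 1)) ≤ LinearMap.ker (shD K (LHs 𝒜 f) n) :=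
    LinearMap.range_le_ker_iff.2 (LinearMap.ext (shD_shD (LHs 𝒜 f) n))
  have hcycle : LinearMap.range (shD K f (n + 1)) ≤ LinearMap.ker (shD K f n) :=
    LinearMap.range_le_ker_iff.2 (LinearMap.ext (shD_shD f n))
  have hboundaries := (comap_subtype_le_iSup_iff hbound
    (by
      rintro p _ ⟨u, rfl⟩
      exact ⟨_, (component_map_of_homogeneous (m := 0) hD'.map_mem p u).symm⟩)
    (leadingParts_le _ (LinearMap.ker (shD K f n)))).2
    fun p => (hD'.range_inf_le p).trans (leadingParts_mono hcycle p)
  rw [extendableHomology_eq_map]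
  refine (Submodule.map_mkQ_eq_top _ _).trans ?_
  rw [sup_eq_right.2 hboundaries, ← hD.ker_le_leadingParts_iff_isStrict,
    ← comap_subtype_le_iSup_iff le_rfl
      (fun p x hx => by
        rw [LinearMap.mem_ker, ← component_map_of_homogeneous (m := 0) hD.map_mem p x,
          LinearMap.mem_ker.1 hx, map_zero])
      (leadingParts_le _ (LinearMap.ker (shD K f n))),
    Submodule.comap_subtype_self, top_le_iff]

end Extendable

/-! ### The bimodule spanned by the extendable classes -/

section GradedAction

variable {K M R : Type*} [Semiring K] [AddCommGroup M] [Module K M] [AddCommMonoid R]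
  [Module K R] {𝒜 : ℕ → Submodule K R} [DirectSum.Decomposition 𝒜]

theorem map_mem_iSup_of_homogeneous {E : ℕ → Submodule K M} {T : R → M →ₗ[K] M}
    (hadd : ∀ r s x, T (r + s) x = T r x + T s x)
    (hT : ∀ m, ∀ r ∈ 𝒜 m, ∀ p, ∀ x ∈ E p, T r x ∈ E (p + m)) (r : R) {x : M}
    (hx : x ∈ ⨆ p, E p) : T r x ∈ ⨆ p, E p := by
  induction r using DirectSum.Decomposition.inductionOn 𝒜 with
  | zero =>
    have hzero : T 0 x = 0 := by simpa only [add_zero, left_eq_add] using hadd 0 0 x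
    exact hzero ▸ zero_mem _
  | @homogeneous m r =>
    have hle : ⨆ p, E p ≤ (⨆ p, E p).comap (T r) :=
      iSup_le fun p y hy => Submodule.mem_iSup_of_mem (p + m) (hT m r r.2 p y hy)
    exact hle hx
  | add r s hr hs => exact hadd r s x ▸ add_mem hr hs

end GradedAction

section ShafarevichBimodule

variable {K R J : Type*} [Field K] [Ring R] [Algebra K R]

theorem shLeft_add (r s : R) (n : ℕ) (z : Sh K R J n) :
    shLeft K J (r + s) n z = shLeft K J r n z + shLeft K J s n z := by
  induction z using Sh.ind with
  | zero => simp only [map_zero, add_zero]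
  | smul k z h => simp only [map_smul, h, smul_add]
  | add y z hy hz => simp only [map_add, hy, hz, add_add_add_comm]
  | tensor w a =>
    rw [shLeft_tensor, shLeft_tensor, shLeft_tensor]
    simp only [Sh.tensor, add_mul, MultilinearMap.map_update_add, Finsupp.single_add]

theorem shRight_add (r s : R) (n : ℕ) (z : Sh K R J n) :
    shRight K J (r + s) n z = shRight K J r n z + shRight K J s n z := by
  induction z using Sh.ind with
  | zero => simp only [map_zero, add_zero]
  | smul k z h => simp only [map_smul, h, smul_add]
  | add y z hy hz => simp only [map_add, hy, hz, add_add_add_comm]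
  | tensor w a =>
    rw [shRight_tensor, shRight_tensor, shRight_tensor]
    simp only [Sh.tensor, mul_add, MultilinearMap.map_update_add, Finsupp.single_add]

theorem homologyLeft_add (c : J → R) (n : ℕ) (r s : R) (h : shHomology (K := K) c n) :
    homologyLeft c n (r + s) h = homologyLeft c n r h + homologyLeft c n s h := by
  obtain ⟨z, rfl⟩ := Homology.mk_surjective _ _ h
  exact congrArg (Homology.mk _ _) (Subtype.ext (shLeft_add r s (n + 1) z.1))

theorem homologyRight_add (c : J → R) (n : ℕ) (r s : R) (h : shHomology (K := K) c n) :
    homologyRight c n (r + s) h = homologyRight c n r h + homologyRight c n s h := by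
  obtain ⟨z, rfl⟩ := Homology.mk_surjective _ _ h
  exact congrArg (Homology.mk _ _) (Subtype.ext (shRight_add r s (n + 1) z.1))

variable {𝒜 : ℕ → Submodule K R} (e : J → ℕ)

theorem Sh.tensor_update_mem_shDeg {n p m : ℕ} {a : Fin (n + 1) → R} {q : Fin (n + 1) → ℕ}
    (ha : ∀ i, a i ∈ 𝒜 (q i)) (w : Fin n → J) (hp : ∑ i, q i + ∑ i, e (w i) = p)
    (k : Fin (n + 1)) {x : R} (hx : x ∈ 𝒜 (q k + m)) :
    Sh.tensor K w (Function.update a k x) ∈ shDeg 𝒜 e n (p + m) := by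
  refine Sh.tensor_mem_shDeg e (q := Function.update q k (q k + m)) (fun i => ?_) w ?_
  · obtain rfl | hi := eq_or_ne i k
    · rwa [Function.update_self, Function.update_self]
    · rw [Function.update_of_ne hi, Function.update_of_ne hi]
      exact ha i
  · have hsum := Finset.sum_update_of_mem (Finset.mem_univ k) q (q k)
    rw [Function.update_eq_self] at hsum
    rw [Finset.sum_update_of_mem (Finset.mem_univ k)]
    omega

variable [SetLike.GradedMul 𝒜] {e}

theorem shLeft_mem_shDeg {n m : ℕ} {r : R} (hr : r ∈ 𝒜 m) (p : ℕ) :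
    ∀ z ∈ shDeg 𝒜 e n p, shLeft K J r n z ∈ shDeg 𝒜 e n (p + m) := by
  suffices h : shDeg 𝒜 e n p ≤ (shDeg 𝒜 e n (p + m)).comap (shLeft K J r n) from h
  refine Submodule.span_le.2 ?_
  rintro _ ⟨w, a, q, ha, hp, rfl⟩
  rw [SetLike.mem_coe, Submodule.mem_comap, shLeft_tensor]
  exact Sh.tensor_update_mem_shDeg e ha w hp 0 (add_comm m (q 0) ▸ SetLike.mul_mem_graded hr (ha 0))

theorem shRight_mem_shDeg {n m : ℕ} {r : R} (hr : r ∈ 𝒜 m) (p : ℕ) :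
    ∀ z ∈ shDeg 𝒜 e n p, shRight K J r n z ∈ shDeg 𝒜 e n (p + m) := by
  suffices h : shDeg 𝒜 e n p ≤ (shDeg 𝒜 e n (p + m)).comap (shRight K J r n) from h
  refine Submodule.span_le.2 ?_
  rintro _ ⟨w, a, q, ha, hp, rfl⟩
  rw [SetLike.mem_coe, Submodule.mem_comap, shRight_tensor]
  exact Sh.tensor_update_mem_shDeg e ha w hp _ (SetLike.mul_mem_graded (ha (Fin.last n)) hr)

end ShafarevichBimodule

section ExtendableBimodule

variable {K R J : Type*} [Field K] [Ring R] [Algebra K R] {𝒜 : ℕ → Submodule K R}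
  [GradedAlgebra 𝒜] {f : J → R} {n : ℕ}

theorem homologyLeft_mem_extendable {m : ℕ} {r : R} (hr : r ∈ 𝒜 m) {p : ℕ}
    {h : shHomology (K := K) (LHs 𝒜 f) n} (hh : h ∈ extendable 𝒜 f n p) :
    homologyLeft (LHs 𝒜 f) n r h ∈ extendable 𝒜 f n (p + m) := by
  obtain ⟨z, hz, rfl⟩ := mem_extendable_iff.1 hh
  have hker : LinearMap.ker (shD K f n) ≤
      (LinearMap.ker (shD K f n)).comap (shLeft K J r (n + 1)) := fun y hy => by
      rw [Submodule.mem_comap, LinearMap.mem_ker, ← shD_shLeft, LinearMap.mem_ker.1 hy, map_zero]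
  exact mem_extendable_iff.2 ⟨⟨shLeft K J r (n + 1) z, _⟩,
    map_mem_leadingParts (shLeft_mem_shDeg hr) hker hz, rfl⟩

theorem homologyRight_mem_extendable {m : ℕ} {r : R} (hr : r ∈ 𝒜 m) {p : ℕ}
    {h : shHomology (K := K) (LHs 𝒜 f) n} (hh : h ∈ extendable 𝒜 f n p) :
    homologyRight (LHs 𝒜 f) n r h ∈ extendable 𝒜 f n (p + m) := by
  obtain ⟨z, hz, rfl⟩ := mem_extendable_iff.1 hh
  have hker : LinearMap.ker (shD K f n) ≤
      (LinearMap.ker (shD K f n)).comap (shRight K J r (n + 1)) := fun y hy => by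
      rw [Submodule.mem_comap, LinearMap.mem_ker, ← shD_shRight, LinearMap.mem_ker.1 hy, map_zero]
  exact mem_extendable_iff.2 ⟨⟨shRight K J r (n + 1) z, _⟩,
    map_mem_leadingParts (shRight_mem_shDeg hr) hker hz, rfl⟩

variable (𝒜 f n)

theorem bimoduleSpan_extendable :
    bimoduleSpan (LHs 𝒜 f) n {h | ∃ p, h ∈ extendable 𝒜 f n p} = extendableHomology 𝒜 f n := by
  apply le_antisymm
  · refine sInf_le ⟨fun h ⟨p, hp⟩ => Submodule.mem_iSup_of_mem p hp, fun r h hh => ⟨?_, ?_⟩⟩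
    · exact map_mem_iSup_of_homogeneous (E := extendable 𝒜 f n) (homologyLeft_add (LHs 𝒜 f) n)
        (fun m r hr p h hp => homologyLeft_mem_extendable hr hp) r hh
    · exact map_mem_iSup_of_homogeneous (E := extendable 𝒜 f n) (homologyRight_add (LHs 𝒜 f) n)
        (fun m r hr p h hp => homologyRight_mem_extendable hr hp) r hh
  · exact le_sInf fun N hN => iSup_le fun p h hh => hN.1 ⟨p, hh⟩

end ExtendableBimodule

/-! ### Leading parts of an ideal -/

section LeadingIdeal

variable {K R : Type*} [Field K] [Ring R] [Algebra K R] {𝒜 : ℕ → Submodule K R}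
  [GradedAlgebra 𝒜]

theorem deg_le_of_mem_degLE {p : ℕ} {r : R} (hr : r ∈ degLE 𝒜 p) : deg 𝒜 r ≤ p := by
  classical
  refine Finset.sup_le fun i hi => not_lt.1 fun hpi => ?_
  exact DFinsupp.mem_support_iff.1 hi (Subtype.ext (mem_degLE_iff.1 hr i hpi))

theorem component_eq_LH_or_eq_zero {p : ℕ} {r : R} (hr : r ∈ degLE 𝒜 p) :
    component 𝒜 p r = LH 𝒜 r ∨ component 𝒜 p r = 0 := by
  obtain rfl | hlt := (deg_le_of_mem_degLE hr).eq_or_lt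
  · exact .inl rfl
  · exact .inr (mem_degLE_iff.1 (mem_gradingFil_deg 𝒜 r) p hlt)

theorem span_LH_le_iff {I L : TwoSidedIdeal R} :
    TwoSidedIdeal.span (LH 𝒜 '' (I : Set R)) ≤ L ↔
      ∀ p, leadingParts 𝒜 (I.asIdeal.restrictScalars K) p ≤ L.asIdeal.restrictScalars K := by
  rw [TwoSidedIdeal.span_le]
  constructor
  · rintro h p _ ⟨r, ⟨hr, hrp⟩, rfl⟩
    obtain hLH | hzero := component_eq_LH_or_eq_zero hrp
    · exact hLH ▸ h ⟨r, hr, rfl⟩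
    · exact hzero ▸ zero_mem _
  · rintro h _ ⟨r, hr, rfl⟩
    exact h (deg 𝒜 r) ⟨r, ⟨hr, mem_gradingFil_deg 𝒜 r⟩, rfl⟩

end LeadingIdeal

/-! ### The first differential as a presentation of the ideal -/

section Augmentation

variable (K : Type*) {R J : Type*} [Field K] [Ring R] [Algebra K R]

variable (R J) in
/-- The identification of `Sh 0`, which has a single word and a single tensor factor, with `R`. -/
def shZeroEquiv : Sh K R J 0 ≃ₗ[K] R :=
  Finsupp.uniqueLinearEquiv K _ (default : Fin 0 → J) ≪≫ₗ
    PiTensorProduct.subsingletonEquiv (ι := Fin 1) 0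

variable {K} in
theorem shZeroEquiv_tensor (w : Fin 0 → J) (a : Fin 1 → R) :
    shZeroEquiv K R J (Sh.tensor K w a) = a 0 := by
  obtain rfl : w = default := Subsingleton.elim _ _
  simp [shZeroEquiv, Sh.tensor]

/-- The differential `Sh 1 → Sh 0` with values in `R`. -/
def shDZero (c : J → R) : Sh K R J 1 →ₗ[K] R :=
  (shZeroEquiv K R J).toLinearMap ∘ₗ shD K c 0

variable {K}

theorem shDZero_tensor (c : J → R) (w : Fin 1 → J) (a : Fin 2 → R) :
    shDZero K c (Sh.tensor K w a) = a 0 * c (w 0) * a 1 := by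
  rw [shDZero, LinearMap.comp_apply, shD_tensor]
  simp [shZeroEquiv_tensor, contract_self]

theorem ker_shDZero (c : J → R) : LinearMap.ker (shDZero K c) = LinearMap.ker (shD K c 0) :=
  LinearEquiv.ker_comp _ _

theorem range_shDZero (c : J → R) :
    LinearMap.range (shDZero K c) =
      (TwoSidedIdeal.span (Set.range c)).asIdeal.restrictScalars K := by
  apply le_antisymm
  · rintro _ ⟨z, rfl⟩
    induction z using Sh.ind with
    | zero => exact map_zero (shDZero K c) ▸ zero_mem _
    | smul k z h => exact map_smul (shDZero K c) k z ▸ Submodule.smul_mem _ k h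
    | add y z hy hz => exact map_add (shDZero K c) y z ▸ add_mem hy hz
    | tensor w a =>
      rw [shDZero_tensor]
      exact TwoSidedIdeal.mul_mem_right _ _ _ (TwoSidedIdeal.mul_mem_left _ _ _
        (TwoSidedIdeal.subset_span (Set.mem_range_self (w 0))))
  · intro r hr
    refine (AddSubgroup.closure_le (LinearMap.range (shDZero K c)).toAddSubgroup).2 ?_
      (TwoSidedIdeal.mem_span_iff_mem_addSubgroup_closure.1 hr)
    rintro _ ⟨_, ⟨a, -, _, ⟨j, rfl⟩, rfl⟩, b, -, rfl⟩
    exact ⟨Sh.tensor K (fun _ => j) ![a, b], shDZero_tensor c _ _⟩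

variable {𝒜 : ℕ → Submodule K R}

theorem shZeroEquiv_mem {e : J → ℕ} (p : ℕ) :
    ∀ z ∈ shDeg 𝒜 e 0 p, (shZeroEquiv K R J).toLinearMap z ∈ 𝒜 p := by
  suffices h : shDeg 𝒜 e 0 p ≤ (𝒜 p).comap (shZeroEquiv K R J).toLinearMap from h
  refine Submodule.span_le.2 ?_
  rintro _ ⟨w, a, q, ha, rfl, rfl⟩
  simpa [shZeroEquiv_tensor] using ha 0

variable (𝒜) [GradedAlgebra 𝒜] (f : J → R)

theorem isLeadingPart_shDZero_LHs :
    IsLeadingPart (shDeg 𝒜 (degs 𝒜 f) 1) 𝒜 (shDZero K f) (shDZero K (LHs 𝒜 f)) :=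
  (isLeadingPart_shD_LHs 𝒜 f 0).comp_left shZeroEquiv_mem

theorem isStrict_shD_zero_iff :
    IsStrict (degLE (shDeg 𝒜 (degs 𝒜 f) 1)) (degLE (shDeg 𝒜 (degs 𝒜 f) 0)) (shD K f 0) ↔
      IsStrict (degLE (shDeg 𝒜 (degs 𝒜 f) 1)) (degLE 𝒜) (shDZero K f) := by
  rw [← (isLeadingPart_shD_LHs 𝒜 f 0).ker_le_leadingParts_iff_isStrict,
    ← (isLeadingPart_shDZero_LHs 𝒜 f).ker_le_leadingParts_iff_isStrict, ker_shDZero, ker_shDZero]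

theorem span_LHs_eq_iff_isStrict :
    TwoSidedIdeal.span (Set.range (LHs 𝒜 f)) =
        TwoSidedIdeal.span (LH 𝒜 '' (TwoSidedIdeal.span (Set.range f) : Set R)) ↔
      IsStrict (degLE (shDeg 𝒜 (degs 𝒜 f) 1)) (degLE (shDeg 𝒜 (degs 𝒜 f) 0)) (shD K f 0) := by
  have hle : TwoSidedIdeal.span (Set.range (LHs 𝒜 f)) ≤
      TwoSidedIdeal.span (LH 𝒜 '' (TwoSidedIdeal.span (Set.range f) : Set R)) := by
    refine TwoSidedIdeal.span_mono ?_
    rintro _ ⟨j, rfl⟩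
    exact ⟨f j, TwoSidedIdeal.subset_span ⟨j, rfl⟩, rfl⟩
  rw [isStrict_shD_zero_iff, (isLeadingPart_shDZero_LHs 𝒜 f).isStrict_iff_leadingParts_range_le,
    range_shDZero, range_shDZero, ← span_LH_le_iff, hle.ge_iff_eq]

end Augmentation

/-! ### The associated graded algebra of the quotient -/

section AssociatedGraded

variable {K R : Type*} [Field K] [Ring R] [Algebra K R] {𝒜 : ℕ → Submodule K R}
  {I : TwoSidedIdeal R}

theorem mem_prev_quotFil_iff {p : ℕ} {r : R} :
    Ideal.Quotient.mkₐ K I.asIdeal r ∈ prev (quotFil 𝒜 I) p ↔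
      ∃ s ∈ prev (degLE 𝒜) p, r - s ∈ I.asIdeal := by
  have hmap : prev (quotFil 𝒜 I) p =
      (prev (degLE 𝒜) p).map (Ideal.Quotient.mkₐ K I.asIdeal).toLinearMap := by
    cases p with
    | zero => exact (Submodule.map_bot _).symm
    | succ p => rfl
  rw [hmap, Submodule.mem_map]
  refine exists_congr fun s => and_congr_right fun _ => ?_
  exact eq_comm.trans Ideal.Quotient.eq

variable (𝒜 I)

/-- The homogeneous part of degree `p` of the natural graded map `R → G(R / I)`. -/
def natGrPart (p : ℕ) : 𝒜 p →ₗ[K] Gr (quotFil 𝒜 I) p :=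
  Gr.proj (quotFil 𝒜 I) p ∘ₗ (Ideal.Quotient.mkₐ K I.asIdeal).toLinearMap.restrict
    fun _ hr => Submodule.mem_map_of_mem (mem_gradingFil 𝒜 le_rfl hr)

variable [GradedAlgebra 𝒜]

variable {𝒜 I} in
theorem natGrPart_eq_zero_iff {p : ℕ} (r : 𝒜 p) :
    natGrPart 𝒜 I p r = 0 ↔ (r : R) ∈ leadingParts 𝒜 (I.asIdeal.restrictScalars K) p := by
  have hr : (r : R) ∈ degLE 𝒜 p := le_degLE 𝒜 le_rfl r.2
  refine (Submodule.Quotient.mk_eq_zero _).trans (mem_prev_quotFil_iff.trans ?_)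
  constructor
  · rintro ⟨s, hs, hrs⟩
    obtain ⟨hsp, hs₀⟩ := mem_prev_degLE_iff.1 hs
    exact ⟨r - s, ⟨hrs, sub_mem hr hsp⟩, by rw [map_sub, hs₀, sub_zero, component_of_mem_same r.2]⟩
  · rintro ⟨y, ⟨hy, hyp⟩, hyr⟩
    refine ⟨r - y, (sub_mem_prev_degLE_iff hr hyp).2 ?_, (sub_sub_cancel (r : R) y).symm ▸ hy⟩
    rw [hyr, component_of_mem_same r.2]

theorem natGrPart_surjective (p : ℕ) : Function.Surjective (natGrPart 𝒜 I p) := by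
  intro x
  induction x using Gr.ind with | _ a ha
  obtain ⟨r, hr, rfl⟩ := ha
  refine ⟨⟨component 𝒜 p r, component_mem 𝒜 p r⟩, Eq.symm ?_⟩
  refine (Gr.proj_eq_iff (F := quotFil 𝒜 I) ⟨_, _⟩ ⟨_, _⟩).2 ?_
  change Ideal.Quotient.mkₐ K I.asIdeal r - Ideal.Quotient.mkₐ K I.asIdeal (component 𝒜 p r) ∈ _
  rw [← map_sub, mem_prev_quotFil_iff]
  exact ⟨_, sub_component_mem_prev_degLE hr, by rw [sub_self]; exact zero_mem _⟩

theorem natGr_eq_lmap : natGr 𝒜 I =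
    DirectSum.lmap (natGrPart 𝒜 I) ∘ₗ (DirectSum.decomposeLinearEquiv 𝒜).toLinearMap := by
  refine congrArg (· ∘ₗ _) (DirectSum.linearMap_ext K fun p => LinearMap.ext fun r => ?_)
  rw [LinearMap.comp_apply, LinearMap.comp_apply, DirectSum.toModule_lof, DirectSum.lmap_lof]
  rfl

theorem natGr_of_mem {p : ℕ} {r : R} (hr : r ∈ 𝒜 p) :
    natGr 𝒜 I r = DirectSum.of (Gr (quotFil 𝒜 I)) p (natGrPart 𝒜 I p ⟨r, hr⟩) := by
  rw [natGr_eq_lmap, LinearMap.comp_apply, LinearEquiv.coe_coe,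
    DirectSum.decomposeLinearEquiv_apply, DirectSum.decompose_of_mem 𝒜 hr, DirectSum.lmap_of]

theorem natGr_surjective : Function.Surjective (natGr 𝒜 I) := by
  rw [natGr_eq_lmap, LinearMap.coe_comp]
  exact ((DirectSum.lmap_surjective _).2 (natGrPart_surjective 𝒜 I)).comp
    (DirectSum.decomposeLinearEquiv 𝒜).surjective

theorem natGr_mul (a b : R) : natGr 𝒜 I (a * b) = natGr 𝒜 I a * natGr 𝒜 I b := by
  induction a using DirectSum.Decomposition.inductionOn 𝒜 with
  | zero => simp only [zero_mul, map_zero]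
  | add a a' h h' => simp only [add_mul, map_add, h, h']
  | @homogeneous p a =>
    induction b using DirectSum.Decomposition.inductionOn 𝒜 with
    | zero => simp only [mul_zero, map_zero]
    | add b b' h h' => simp only [mul_add, map_add, h, h']
    | @homogeneous q b =>
      rw [natGr_of_mem 𝒜 I a.2, natGr_of_mem 𝒜 I b.2,
        natGr_of_mem 𝒜 I (SetLike.mul_mem_graded a.2 b.2), DirectSum.of_mul_of]
      rfl

/-- The natural graded map `R → G(R / I)` as a homomorphism of algebras. -/
def natGrHom : R →ₐ[K] GrQuot 𝒜 I :=
  AlgHom.ofLinearMap (natGr 𝒜 I) (natGr_of_mem 𝒜 I SetLike.GradedOne.one_mem) (natGr_mul 𝒜 I)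

variable {𝒜 I} in
theorem natGr_eq_zero_iff {r : R} : natGr 𝒜 I r = 0 ↔
    ∀ p, component 𝒜 p r ∈ leadingParts 𝒜 (I.asIdeal.restrictScalars K) p := by
  rw [natGr_eq_lmap]
  exact DFinsupp.ext_iff.trans (forall_congr' fun p => natGrPart_eq_zero_iff _)

theorem ker_natGrHom :
    RingHom.ker (natGrHom 𝒜 I) = (TwoSidedIdeal.span (LH 𝒜 '' (I : Set R))).asIdeal := by
  classical
  ext r
  constructor
  · intro hr
    rw [← DirectSum.sum_support_decompose 𝒜 r]
    exact sum_mem fun p _ => span_LH_le_iff.1 le_rfl p (natGr_eq_zero_iff.1 hr p)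
  · suffices h : TwoSidedIdeal.span (LH 𝒜 '' (I : Set R)) ≤ TwoSidedIdeal.ker (natGrHom 𝒜 I) from
      fun hr => (TwoSidedIdeal.mem_ker _).1 (h hr)
    refine span_LH_le_iff.2 fun p x hx => (TwoSidedIdeal.mem_ker _).2 ?_
    have hxp := leadingParts_le 𝒜 _ p hx
    refine (natGr_of_mem 𝒜 I hxp).trans ?_
    rw [(natGrPart_eq_zero_iff ⟨x, hxp⟩).2 hx, map_zero]

theorem exists_algEquiv_quotient_iff {A B : Type*} [Ring A] [Algebra K A] [Ring B] [Algebra K B]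
    {L : Ideal A} [L.IsTwoSided] {g : A →ₐ[K] B} (hg : Function.Surjective g) :
    (∃ ρ : (A ⧸ L) ≃ₐ[K] B, ∀ a, ρ (Ideal.Quotient.mk L a) = g a) ↔ L = RingHom.ker g := by
  constructor
  · rintro ⟨ρ, hρ⟩
    ext a
    rw [RingHom.mem_ker, ← hρ, map_eq_zero_iff ρ ρ.injective, Ideal.Quotient.eq_zero_iff_mem]
  · rintro rfl
    exact ⟨Ideal.quotientKerAlgEquivOfSurjective hg, Ideal.quotientKerAlgEquivOfSurjective_mk hg⟩

theorem exists_algEquiv_grQuot_iff (L : TwoSidedIdeal R) :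
    (∃ ρ : (R ⧸ L.asIdeal) ≃ₐ[K] GrQuot 𝒜 I,
      ∀ r : R, ρ (Ideal.Quotient.mk _ r) = natGr 𝒜 I r) ↔
        L = TwoSidedIdeal.span (LH 𝒜 '' (I : Set R)) := by
  refine (exists_algEquiv_quotient_iff (g := natGrHom 𝒜 I) (natGr_surjective 𝒜 I)).trans ?_
  rw [ker_natGrHom, SetLike.ext'_iff, TwoSidedIdeal.coe_asIdeal, TwoSidedIdeal.coe_asIdeal,
    SetLike.coe_set_eq]

end AssociatedGraded

end PBW

theorem theorem3p1 {K R J : Type*} [Field K] [Ring R] [Algebra K R]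
    (𝒜 : ℕ → Submodule K R) [GradedAlgebra 𝒜]
    (I : TwoSidedIdeal R) (f : J → R) (hf : TwoSidedIdeal.span (Set.range f) = I) :
    List.TFAE [
      TwoSidedIdeal.span (Set.range fun j => PBW.LH 𝒜 (f j)) =
        TwoSidedIdeal.span (PBW.LH 𝒜 '' (I : Set R)),
      ∃ ρ : (R ⧸ (TwoSidedIdeal.span (Set.range fun j => PBW.LH 𝒜 (f j))).asIdeal) ≃ₐ[K]
          PBW.GrQuot 𝒜 I,
        ∀ r : R, ρ (Ideal.Quotient.mk _ r) = PBW.natGr 𝒜 I r,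
      PBW.extendableHomology 𝒜 f 0 = ⊤,
      PBW.bimoduleSpan (PBW.LHs 𝒜 f) 0 {h | ∃ p, h ∈ PBW.extendable 𝒜 f 0 p} = ⊤] := by
  subst hf
  tfae_have 1 ↔ 2 := (PBW.exists_algEquiv_grQuot_iff 𝒜 _ _).symm
  tfae_have 1 ↔ 3 := (PBW.span_LHs_eq_iff_isStrict 𝒜 f).trans
    (PBW.extendableHomology_eq_top_iff_isStrict 𝒜 f 0).symm
  tfae_have 4 ↔ 3 := by rw [PBW.bimoduleSpan_extendable]
  tfae_finish
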